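/- **Proposition (explicit Poisson bracket on the dual of an $\mathfrak{LP}$-bundle).** Let $Q$ be a smooth finite-dimensional Hausdorff manifold without boundary and $V\to Q$ a smooth real vector bundle of finite rank, equipped with a smooth field of Lie algebra brackets $[\cdot,\cdot]$ on its fibres, a smooth $V$-valued $2$-form $\omega$ on $Q$ and a smooth affine connection $\nabla$ on $V$. Suppose that $TQ\oplus V$ is an $\mathfrak{LP}$-bundle, i.e. that $$[X_1\oplus w_1,X_2\oplus w_2]=[X_1,X_2]\oplus\big(\nabla_{X_1}w_2-\nabla_{X_2}w_1-\omega(X_1,X_2)+[w_1,w_2]\big)$$ is a Lie bracket on the smooth sections of $TQ\oplus V$. For $f\in C^\infty(Q)$ let $\bar f$ be its pullback to $T^*Q\oplus V^*$, and for a smooth section $X\oplus w$ of $TQ\oplus V$ let $P(X\oplus w)(p\oplus\nu)=\langle p,X\rangle+\langle\nu,w\rangle$. Then there is exactly one Poisson bracket $\{\cdot,\cdot\}$ on $C^\infty(T^*Q\oplus V^*)$ (an $\mathbb R$-bilinear, alternating operation satisfying the Jacobi and Leibniz identities) such that $$\{\bar f,\bar g\}=0,\qquad \{\bar f,P(X\oplus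 w)\}=\overline{X[f]},\qquad \{P(X_1\oplus w_1),P(X_2\oplus w_2)\}=-P([X_1\oplus w_1,X_2\oplus w_2]),$$ and it is given, for all $f,g\in C^\infty(T^*Q\oplus V^*)$ and at every point $(q,p,\nu)$, by $$\{f,g\}=\frac{\partial f}{\partial q}\frac{\partial g}{\partial p}-\frac{\partial g}{\partial q}\frac{\partial f}{\partial p}+\Big\langle\nu,\omega\Big(\frac{\partial f}{\partial p},\frac{\partial g}{\partial p}\Big)\Big\rangle+\Big\langle\nu,\Big[\frac{\partial g}{\partial\nu},\frac{\partial f}{\partial\nu}\Big]\Big\rangle .$$ Here $\frac{\partial f}{\partial p}\in T_qQ$ and $\frac{\partial f}{\partial\nu}\in V_q$ represent the derivatives of $f$ along the fibres of $T^*Q$ and $V^*$, and $\frac{\partial f}{\partial q}\in T_q^*Q$ is the derivative of $f$ along the horizontal space of the connection on $T^*Q\oplus V^*$ dual to $\nabla^Q\oplus\nabla$, that is, $\frac{\partial f}{\partial q}=d(f\circ s)_q$ for any section $s$ through $(q,p,\nu)$ that is parallel at $q$. The connection $\nabla^Q$ on $TQ$ may be the flat connection of any chart of $Q$ around $q$ (so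 that $\frac{\partial f}{\partial q}$ is the derivative in $q$ with the components of $p$ in that chart kept constant and $\nu$ transported by $\nabla$), or any torsion-free affine connection on the tangent bundle of an open set containing $q$; the right-hand side is the same for all these choices. -/

import Mathlib

open Bundle Manifold
open scoped ContDiff Topology

noncomputable section

namespace LagrangePoincare

/-! ### Poisson brackets on a commutative algebra -/

/-- A bilinear operation on a commutative real algebra is a Poisson bracket if it is alternating
and satisfies the Jacobi and Leibniz identities. -/
structure IsPoissonBracket {A : Type*} [CommRing A] [Algebra ℝ A] (B : A →ₗ[ℝ] A →ₗ[ℝ] A) :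
    Prop where
  alternating : ∀ a, B a a = 0
  jacobi : ∀ a b c, B a (B b c) + B b (B c a) + B c (B a b) = 0
  leibniz : ∀ a b c, B a (b * c) = B a b * c + b * B a c

section Structures

variable {E : Type*} [NormedAddCommGroup E] [NormedSpace ℝ E]
  {H : Type*} [TopologicalSpace H] (I : ModelWithCorners ℝ E H)
  {Q : Type*} [TopologicalSpace Q] [ChartedSpace H Q] [IsManifold I ∞ Q]
  (F : Type*) [NormedAddCommGroup F] [NormedSpace ℝ F]
  (V : Q → Type*) [TopologicalSpace (TotalSpace F V)]
  [∀ q, AddCommGroup (V q)] [∀ q, Module ℝ (V q)] [∀ q, TopologicalSpace (V q)]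
  [∀ q, IsTopologicalAddGroup (V q)] [∀ q, ContinuousSMul ℝ (V q)]
  [FiberBundle F V] [VectorBundle ℝ F V]

/-! ### Lagrange-Poincare bundles -/

/-- The structures carried by a Lagrange-Poincare bundle `TQ ⊕ V`: a smooth field of Lie algebra
structures on the fibres of `V` (when `nabla` preserves it, as in every Lagrange-Poincare bundle,
parallel transport makes it locally trivial), a smooth `V`-valued two-form `form` (written `ω` below) on `Q` and a smooth affine
connection `nabla` on `V`. Mathlib's argument order is `nabla w q (X q) = (∇_X w)(q)`. -/
structure PreLPBundle where
  /-- the Lie bracket on each fibre -/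
  lie : ∀ q, V q →L[ℝ] V q →L[ℝ] V q
  lie_self : ∀ q v, lie q v v = 0
  lie_jacobi : ∀ q u v w,
    lie q u (lie q v w) + lie q v (lie q w u) + lie q w (lie q u v) = 0
  lie_smooth : ContMDiff I (I.prod 𝓘(ℝ, F →L[ℝ] F →L[ℝ] F)) ∞
    (fun q ↦ TotalSpace.mk' (F →L[ℝ] F →L[ℝ] F) (E := fun q ↦ V q →L[ℝ] V q →L[ℝ] V q) q (lie q))
  /-- the `V`-valued two-form -/
  form : ∀ q, TangentSpace I q →L[ℝ] TangentSpace I q →L[ℝ] V q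
  form_self : ∀ q X, form q X X = 0
  form_smooth : ContMDiff I (I.prod 𝓘(ℝ, E →L[ℝ] E →L[ℝ] F)) ∞
    (fun q ↦ TotalSpace.mk' (E →L[ℝ] E →L[ℝ] F)
      (E := fun q ↦ TangentSpace I q →L[ℝ] TangentSpace I q →L[ℝ] V q) q (form q))
  /-- the affine connection on `V` -/
  nabla : CovariantDerivative I F V
  nabla_smooth : CovariantDerivative.ContMDiffCovariantDerivative nabla ∞

variable {I F V}

/-- The operation on sections `X ⊕ w` of `TQ ⊕ V`,
`[X₁ ⊕ w₁, X₂ ⊕ w₂] = [X₁, X₂] ⊕ (∇_{X₁} w₂ - ∇_{X₂} w₁ - ω(X₁, X₂) + [w₁, w₂])`. -/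
def PreLPBundle.bracket (S : PreLPBundle I F V)
    (a b : (∀ q : Q, TangentSpace I q) × (∀ q, V q)) :
    (∀ q : Q, TangentSpace I q) × (∀ q, V q) :=
  (VectorField.mlieBracket I a.1 b.1,
    fun q ↦ S.nabla b.2 q (a.1 q) - S.nabla a.2 q (b.1 q) - S.form q (a.1 q) (b.1 q)
      + S.lie q (a.2 q) (b.2 q))

variable (I F V) in
/-- A Lagrange-Poincare bundle: the above operation is a Lie bracket on the smooth sections of
`TQ ⊕ V`. (It is bilinear and alternating in any case, so only the Jacobi identity is asked.) -/
structure LPBundle extends PreLPBundle I F V where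
  jacobi : ∀ (X₁ X₂ X₃ : Cₛ^∞⟮I; E, (TangentSpace I : Q → Type _)⟯) (w₁ w₂ w₃ : Cₛ^∞⟮I; F, V⟯),
    toPreLPBundle.bracket (⇑X₁, ⇑w₁) (toPreLPBundle.bracket (⇑X₂, ⇑w₂) (⇑X₃, ⇑w₃))
      + toPreLPBundle.bracket (⇑X₂, ⇑w₂) (toPreLPBundle.bracket (⇑X₃, ⇑w₃) (⇑X₁, ⇑w₁))
      + toPreLPBundle.bracket (⇑X₃, ⇑w₃) (toPreLPBundle.bracket (⇑X₁, ⇑w₁) (⇑X₂, ⇑w₂)) = 0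

/-! ### The dual bundle `T*Q ⊕ V*` -/

variable (I) in
/-- The cotangent bundle of `Q`. -/
abbrev CotangentFiber (q : Q) : Type _ := TangentSpace I q →L[ℝ] Trivial Q ℝ q

variable (V) in
/-- The dual bundle of `V`. -/
abbrev DualFiber (q : Q) : Type _ := V q →L[ℝ] Trivial Q ℝ q

variable (I F V) in
/-- The total space of `T*Q ⊕ V* → Q`; its points are `⟨q, (p, ν)⟩`. -/
abbrev LPDual : Type _ :=
  TotalSpace ((E →L[ℝ] ℝ) × (F →L[ℝ] ℝ)) (CotangentFiber I (Q := Q) ×ᵇ DualFiber V)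

variable (I F) in
/-- The model with corners of the manifold `T*Q ⊕ V*`. -/
abbrev dualModel := I.prod 𝓘(ℝ, (E →L[ℝ] ℝ) × (F →L[ℝ] ℝ))

/-! ### Smooth functions on `T*Q ⊕ V*` -/

variable (I F V) in
/-- The algebra `C^∞(T*Q ⊕ V*)`. -/
abbrev DualAlgebra : Type _ := C^∞⟮dualModel I F, LPDual I F V; 𝓘(ℝ), ℝ⟯

variable (F V) in
/-- The pullback `f̄` to `T*Q ⊕ V*` of a smooth function `f` on `Q`. -/
def pullback (f : C^∞⟮I, Q; 𝓘(ℝ), ℝ⟯) : DualAlgebra I F V :=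
  ⟨fun x ↦ f x.proj, f.contMDiff.comp (contMDiff_proj _)⟩

/-- The fibrewise linear function `P(X ⊕ w)(p ⊕ ν) = ⟨p, X⟩ + ⟨ν, w⟩` of a section `X ⊕ w`. -/
def linearFun (a : (∀ q : Q, TangentSpace I q) × (∀ q, V q)) (x : LPDual I F V) : ℝ :=
  x.2.1 (a.1 x.proj) + x.2.2 (a.2 x.proj)

theorem contMDiff_fst :
    ContMDiff (dualModel I F) (I.prod 𝓘(ℝ, E →L[ℝ] ℝ)) ∞ (fun x : LPDual I F V ↦
      TotalSpace.mk' (E →L[ℝ] ℝ) (E := CotangentFiber I) x.proj x.2.1) := by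
  intro x
  have h := (contMDiff_id (I := dualModel I F) (M := LPDual I F V) (n := ∞)) x
  rw [contMDiffAt_totalSpace] at h ⊢
  exact ⟨h.1, (ContinuousLinearMap.fst ℝ (E →L[ℝ] ℝ) (F →L[ℝ] ℝ)).contMDiff.contMDiffAt.comp x h.2⟩

theorem contMDiff_snd :
    ContMDiff (dualModel I F) (I.prod 𝓘(ℝ, F →L[ℝ] ℝ)) ∞ (fun x : LPDual I F V ↦
      TotalSpace.mk' (F →L[ℝ] ℝ) (E := DualFiber V) x.proj x.2.2) := by
  intro x
  have h := (contMDiff_id (I := dualModel I F) (M := LPDual I F V) (n := ∞)) x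
  rw [contMDiffAt_totalSpace] at h ⊢
  exact ⟨h.1, (ContinuousLinearMap.snd ℝ (E →L[ℝ] ℝ) (F →L[ℝ] ℝ)).contMDiff.contMDiffAt.comp x h.2⟩

theorem contMDiff_linearFun (X : Cₛ^∞⟮I; E, (TangentSpace I : Q → Type _)⟯)
    (w : Cₛ^∞⟮I; F, V⟯) :
    ContMDiff (dualModel I F) 𝓘(ℝ) ∞
      (linearFun (F := F) (V := V) ((⇑X, ⇑w) : (∀ q : Q, TangentSpace I q) × (∀ q, V q))) := by
  have hproj : ContMDiff (dualModel I F) I ∞ (fun x : LPDual I F V ↦ x.proj) := contMDiff_proj _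
  have h1 := (contMDiff_fst (I := I) (F := F) (V := V)).clm_bundle_apply
    (X.contMDiff.comp hproj)
  have h2 := (contMDiff_snd (I := I) (F := F) (V := V)).clm_bundle_apply
    (w.contMDiff.comp hproj)
  intro x
  have h1' := h1 x
  have h2' := h2 x
  rw [contMDiffAt_totalSpace] at h1' h2'
  exact h1'.2.add h2'.2

/-- `P(X ⊕ w)` as an element of `C^∞(T*Q ⊕ V*)`. -/
def linear (X : Cₛ^∞⟮I; E, (TangentSpace I : Q → Type _)⟯) (w : Cₛ^∞⟮I; F, V⟯) :
    DualAlgebra I F V :=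
  ⟨linearFun (⇑X, ⇑w), contMDiff_linearFun X w⟩

/-- The prescribed values of the bracket on affine functions:
`{f̄, ḡ} = 0`, `{f̄, P(X ⊕ w)} = X[f]` (pulled back) and
`{P(X₁ ⊕ w₁), P(X₂ ⊕ w₂)} = -P([X₁ ⊕ w₁, X₂ ⊕ w₂])`. -/
structure PreLPBundle.IsAffineBracket (S : PreLPBundle I F V)
    (B : DualAlgebra I F V →ₗ[ℝ] DualAlgebra I F V →ₗ[ℝ] DualAlgebra I F V) : Prop where
  pullback_pullback : ∀ f g : C^∞⟮I, Q; 𝓘(ℝ), ℝ⟯, B (pullback F V f) (pullback F V g) = 0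
  pullback_linear : ∀ (f : C^∞⟮I, Q; 𝓘(ℝ), ℝ⟯)
    (X : Cₛ^∞⟮I; E, (TangentSpace I : Q → Type _)⟯) (w : Cₛ^∞⟮I; F, V⟯) (x : LPDual I F V),
    B (pullback F V f) (linear X w) x = mvfderiv I f x.proj (X x.proj)
  linear_linear : ∀ (X₁ X₂ : Cₛ^∞⟮I; E, (TangentSpace I : Q → Type _)⟯)
    (w₁ w₂ : Cₛ^∞⟮I; F, V⟯) (x : LPDual I F V),
    B (linear X₁ w₁) (linear X₂ w₂) x = -linearFun (S.bracket (⇑X₁, ⇑w₁) (⇑X₂, ⇑w₂)) x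

/-! ### Partial derivatives of a function on `T*Q ⊕ V*` -/

/-- `∂f/∂p (x) ∈ T_qQ`: the tangent vector representing the derivative of `f` along the fibre of
`T*Q`, i.e. `⟨α, ∂f/∂p⟩ = d/dt f(p + t α, ν)` at `t = 0` for every covector `α`. -/
def derivP (f : LPDual I F V → ℝ) (x : LPDual I F V) : TangentSpace I x.proj :=
  Classical.epsilon fun ξ ↦ ∀ α : CotangentFiber I x.proj,
    α ξ = lineDeriv ℝ (fun t : CotangentFiber I x.proj × DualFiber V x.proj ↦ f ⟨x.proj, t⟩)
      x.2 (α, 0)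

/-- `∂f/∂ν (x) ∈ V_q`: the vector representing the derivative of `f` along the fibre of `V*`,
i.e. `⟨β, ∂f/∂ν⟩ = d/dt f(p, ν + t β)` at `t = 0` for every `β`. -/
def derivNu (f : LPDual I F V → ℝ) (x : LPDual I F V) : V x.proj :=
  Classical.epsilon fun v ↦ ∀ β : DualFiber V x.proj,
    β v = lineDeriv ℝ (fun t : CotangentFiber I x.proj × DualFiber V x.proj ↦ f ⟨x.proj, t⟩)
      x.2 (0, β)

/-- A local section `s = (s₁, s₂)` of `T*Q ⊕ V*` passes through `x = (q, p, ν)` and is parallel at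
`q` for the connection on `T*Q ⊕ V*` dual to a connection `cov` on `TQ` and `nabla` on `V`:
`d⟨s₁, Y⟩ = ⟨p, ∇Y⟩` and `d⟨s₂, w⟩ = ⟨ν, ∇w⟩` at `q` for all `Y` and `w` differentiable at `q`. -/
structure IsHorizontalSection
    (cov : (∀ q : Q, TangentSpace I q) → ∀ q : Q, TangentSpace I q →L[ℝ] TangentSpace I q)
    (nabla : CovariantDerivative I F V) (x : LPDual I F V)
    (s : ∀ q : Q, CotangentFiber I q × DualFiber V q) : Prop where
  through : s x.proj = x.2
  differentiable : MDifferentiableAt I (dualModel I F)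
    (fun q ↦ (⟨q, s q⟩ : LPDual I F V)) x.proj
  parallel_fst : ∀ Y : ∀ q : Q, TangentSpace I q,
    MDifferentiableAt I (I.prod 𝓘(ℝ, E)) (fun q ↦ TotalSpace.mk' E q (Y q)) x.proj →
    ∀ X, mvfderiv I (fun q ↦ ((s q).1 (Y q) : ℝ)) x.proj X = x.2.1 (cov Y x.proj X)
  parallel_snd : ∀ w : ∀ q, V q,
    MDifferentiableAt I (I.prod 𝓘(ℝ, F)) (fun q ↦ TotalSpace.mk' F q (w q)) x.proj →
    ∀ X, mvfderiv I (fun q ↦ ((s q).2 (w q) : ℝ)) x.proj X = x.2.2 (nabla w x.proj X)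

/-- `∂f/∂q (x) ∈ T*_qQ`: the derivative of `f` along the horizontal space at `x`, which is the
image of `T_qQ` under the differential of any section through `x` that is parallel at `q`. -/
def derivQ
    (cov : (∀ q : Q, TangentSpace I q) → ∀ q : Q, TangentSpace I q →L[ℝ] TangentSpace I q)
    (nabla : CovariantDerivative I F V) (f : LPDual I F V → ℝ) (x : LPDual I F V) :
    TangentSpace I x.proj →L[ℝ] ℝ :=
  mvfderiv I
    (fun q ↦ f ⟨q, Classical.epsilon (fun s ↦ IsHorizontalSection cov nabla x s) q⟩) x.proj

/-- The expression
`∂f/∂q ∂g/∂p - ∂g/∂q ∂f/∂p + ⟨ν, ω(∂f/∂p, ∂g/∂p)⟩ + ⟨ν, [∂g/∂ν, ∂f/∂ν]⟩`. -/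
def PreLPBundle.explicitBracket (S : PreLPBundle I F V)
    (cov : (∀ q : Q, TangentSpace I q) → ∀ q : Q, TangentSpace I q →L[ℝ] TangentSpace I q)
    (f g : LPDual I F V → ℝ) (x : LPDual I F V) : ℝ :=
  derivQ cov S.nabla f x (derivP g x) - derivQ cov S.nabla g x (derivP f x)
    + x.2.2 (S.form x.proj (derivP f x) (derivP g x))
    + x.2.2 (S.lie x.proj (derivNu g x) (derivNu f x))

/-! ### Connections on the tangent bundle -/

/-- The flat connection on the domain of a chart `φ` of `Q`: covariant derivatives of vector
fields are the ordinary derivatives of their components in the chart. For it, `∂f/∂q` is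
the partial derivative in `q` at constant components of `p` with respect to the chart. -/
def chartConnection (φ : OpenPartialHomeomorph Q H) (Y : ∀ q : Q, TangentSpace I q) (q : Q) :
    TangentSpace I q →L[ℝ] TangentSpace I q :=
  (mfderiv I 𝓘(ℝ, E) (φ.extend I) q).inverse.comp
    (mvfderiv I (fun q' : Q ↦ (mfderiv I 𝓘(ℝ, E) (φ.extend I) q' (Y q') : E)) q)

/-- `cov` is a torsion-free affine connection on the tangent bundle of the open set `U`. -/
structure IsTorsionFreeConnectionOn
    (cov : (∀ q : Q, TangentSpace I q) → ∀ q : Q, TangentSpace I q →L[ℝ] TangentSpace I q)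
    (U : Set Q) : Prop where
  isOpen : IsOpen U
  isCovariantDerivativeOn : IsCovariantDerivativeOn E cov U
  torsion_eq_zero : ∀ q ∈ U, ∀ X Y : ∀ q : Q, TangentSpace I q,
    MDifferentiableAt I (I.prod 𝓘(ℝ, E)) (fun q ↦ TotalSpace.mk' E q (X q)) q →
    MDifferentiableAt I (I.prod 𝓘(ℝ, E)) (fun q ↦ TotalSpace.mk' E q (Y q)) q →
    cov Y q (X q) - cov X q (Y q) = VectorField.mlieBracket I X Y q

end Structures

end LagrangePoincare

end

open LagrangePoincare

/-!
Call a function on `T*Q ⊕ V*` affine if it is the pullback of a function on `Q` or the fibrewise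
linear function of a section of `TQ ⊕ V`. The proof rests on the fact that, near every fibre, all
smooth functions are smooth functions of finitely many affine ones (`exists_affine_coordinates`),
namely of the coordinates of a chart of `Q` and of the linear functions of local frames of `TQ` and
`V`, cut off by a bump function on `Q`.

With Hadamard's lemma (`exists_contDiff_sub_eq_sum`) it follows that a derivation of
`C^∞(T*Q ⊕ V*)` vanishing on affine functions is zero (`derivation_eq_zero`). Since a Poisson
bracket is a derivation in each argument, it is determined by its values on affine functions
(`eq_of_forall_derivation`). Likewise the Jacobiator of an antisymmetric biderivation is a
derivation in each argument, so the Jacobi identity has only to be checked on affine functions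
(`jacobi_of_forall_derivation`). There it is the Jacobi identity of the bracket on sections of
`TQ ⊕ V` (`LPBundle.jacobi_of_isAffine`).

For existence, the explicit formula is a bilinear alternating form in the partial derivatives of the
two functions, and these obey the chain rule (`differential_eq_sum`); here one needs that sections
through a given point that are parallel there exist (`exists_isHorizontalSection`). On affine
functions the formula has the prescribed values as soon as the connection on `TQ` is torsion-free
(`explicitBracket_linear_linear`). By the chain rule and the local coordinates above, its values on
all smooth functions are then smooth and do not depend on the connection
(`exists_isExplicitBracket`). The flat connection of a chart is torsion-free on the domain of the
chart (`isTorsionFreeConnectionOn_chartConnection`), so it is one of the connections allowed, and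
there is one around every point.
-/

set_option linter.unusedSectionVars false

noncomputable section

namespace LagrangePoincare

/-! ### Hadamard's lemma -/

section Hadamard

open MeasureTheory

variable {X : Type} [NormedAddCommGroup X] [NormedSpace ℝ X] [FiniteDimensional ℝ X]
  {Y : Type*} [NormedAddCommGroup Y] [NormedSpace ℝ Y]

theorem hasFDerivAt_integral_of_contDiff {Φ : X × ℝ → Y} (hΦ : ContDiff ℝ 1 Φ) (y : X) :
    HasFDerivAt (fun y ↦ ∫ t in (0 : ℝ)..1, Φ (y, t))
      (∫ t in (0 : ℝ)..1, (fderiv ℝ Φ (y, t)).comp (ContinuousLinearMap.inl ℝ X ℝ)) y := by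
  have hc : Continuous fun z : X × ℝ ↦
      (fderiv ℝ Φ z).comp (ContinuousLinearMap.inl ℝ X ℝ) :=
    (hΦ.continuous_fderiv one_ne_zero).clm_comp continuous_const
  obtain ⟨C, hC⟩ := ((isCompact_closedBall y 1).prod isCompact_Icc).exists_bound_of_continuousOn
    (s := Metric.closedBall y 1 ×ˢ Set.Icc (0 : ℝ) 1) hc.continuousOn
  refine (intervalIntegral.hasFDerivAt_integral_of_dominated_of_fderiv_le
    (bound := fun _ ↦ C)
    (F' := fun y t ↦ (fderiv ℝ Φ (y, t)).comp (ContinuousLinearMap.inl ℝ X ℝ))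
    (Metric.closedBall_mem_nhds y one_pos) ?_ ?_ ?_ ?_ ?_ ?_)
  · exact .of_forall fun y ↦
      (hΦ.continuous.comp (Continuous.prodMk_right y)).aestronglyMeasurable
  · exact (hΦ.continuous.comp (Continuous.prodMk_right y)).intervalIntegrable _ _
  · exact (hc.comp (Continuous.prodMk_right y)).aestronglyMeasurable
  · refine .of_forall fun t ht z hz ↦ hC (z, t) ⟨hz, ?_⟩
    rw [Set.uIoc_of_le zero_le_one] at ht
    exact ⟨ht.1.le, ht.2⟩
  · exact intervalIntegrable_const
  · refine .of_forall fun t _ z _ ↦ ?_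
    exact ((hΦ.differentiable one_ne_zero (z, t)).hasFDerivAt).comp z (hasFDerivAt_prodMk_left z t)

/-- A parametric integral of a smooth function over `[0, 1]` is `C^n` for every `n`, by induction:
its derivative is again such an integral, with values in another space. -/
theorem contDiff_integral_nat (n : ℕ) : ∀ {Y : Type _} [NormedAddCommGroup Y] [NormedSpace ℝ Y]
    {Φ : X × ℝ → Y}, ContDiff ℝ ∞ Φ →
    ContDiff ℝ n (fun y ↦ ∫ t in (0 : ℝ)..1, Φ (y, t)) := by
  induction n with
  | zero =>
    intro Y _ _ Φ hΦ
    exact contDiff_zero.2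
      (continuous_iff_continuousAt.2 fun y ↦
        (hasFDerivAt_integral_of_contDiff (hΦ.of_le (by simp)) y).continuousAt)
  | succ n ih =>
    intro Y _ _ Φ hΦ
    refine contDiff_succ_iff_hasFDerivAt.2
      ⟨_, ih (Φ := fun z ↦ (fderiv ℝ Φ z).comp (ContinuousLinearMap.inl ℝ X ℝ)) ?_,
        hasFDerivAt_integral_of_contDiff (hΦ.of_le (by simp))⟩
    exact (hΦ.fderiv_right (m := ∞) (by simp)).clm_comp contDiff_const

/-- Hadamard's lemma: the difference `G y - G y₀` is a combination of the differences of the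
coordinates whose coefficients are again smooth. -/
theorem exists_contDiff_sub_eq_sum {ι : Type} [Fintype ι] {G : (ι → ℝ) → ℝ}
    (hG : ContDiff ℝ ∞ G) (y₀ : ι → ℝ) :
    ∃ g : ι → (ι → ℝ) → ℝ, (∀ i, ContDiff ℝ ∞ (g i)) ∧
      ∀ y, G y - G y₀ = ∑ i, (y i - y₀ i) * g i y := by
  classical
  have hline (y : ι → ℝ) (t : ℝ) :
      HasDerivAt (fun t : ℝ ↦ G (y₀ + t • (y - y₀)))
        (fderiv ℝ G (y₀ + t • (y - y₀)) (y - y₀)) t := by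
    have h1 : HasDerivAt (fun t : ℝ ↦ y₀ + t • (y - y₀)) (y - y₀) t := by
      simpa using ((hasDerivAt_id t).smul_const (y - y₀)).const_add y₀
    exact (hG.differentiable (by simp) _).hasFDerivAt.comp_hasDerivAt t h1
  have hmap : ContDiff ℝ ∞ fun z : (ι → ℝ) × ℝ ↦ y₀ + z.2 • (z.1 - y₀) := by fun_prop
  have hsm (i : ι) : ContDiff ℝ ∞ fun z : (ι → ℝ) × ℝ ↦
      fderiv ℝ G (y₀ + z.2 • (z.1 - y₀)) (Pi.single i 1) :=
    ((hG.fderiv_right (m := ∞) (by simp)).comp hmap).clm_apply contDiff_const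
  -- the coefficients are the mean values of the partial derivatives along the segment to `y`
  refine ⟨fun i y ↦ ∫ t in (0 : ℝ)..1, fderiv ℝ G (y₀ + t • (y - y₀)) (Pi.single i 1),
    fun i ↦ contDiff_infty.2 fun n ↦ contDiff_integral_nat n (hsm i), fun y ↦ ?_⟩
  have hint (i : ι) : IntervalIntegrable
      (fun t ↦ fderiv ℝ G (y₀ + t • (y - y₀)) (Pi.single i 1)) volume 0 1 :=
    ((hsm i).continuous.comp (Continuous.prodMk_right y)).intervalIntegrable _ _
  have hdir (t : ℝ) : fderiv ℝ G (y₀ + t • (y - y₀)) (y - y₀)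
      = ∑ i, (y i - y₀ i) * fderiv ℝ G (y₀ + t • (y - y₀)) (Pi.single i 1) := by
    generalize fderiv ℝ G (y₀ + t • (y - y₀)) = D
    conv_lhs => rw [← Finset.univ_sum_single (y - y₀), map_sum]
    refine Finset.sum_congr rfl fun i _ ↦ ?_
    rw [← mul_one ((y - y₀) i), ← smul_eq_mul, Pi.single_smul, map_smul, smul_eq_mul, Pi.sub_apply]
  have := intervalIntegral.integral_eq_sub_of_hasDerivAt (a := 0) (b := 1)
    (fun t _ ↦ hline y t) ?_
  · simp only [one_smul, zero_smul, add_zero, add_sub_cancel] at this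
    rw [← this]
    simp_rw [hdir]
    rw [intervalIntegral.integral_finsetSum fun i _ ↦ (hint i).const_mul _]
    simp_rw [intervalIntegral.integral_const_mul]
  · simp_rw [hdir]
    simpa only [Finset.sum_fn] using
      IntervalIntegrable.sum Finset.univ fun i _ ↦ (hint i).const_mul (y i - y₀ i)

end Hadamard

section Base

variable {E : Type*} [NormedAddCommGroup E] [NormedSpace ℝ E] [FiniteDimensional ℝ E]
  {H : Type*} [TopologicalSpace H] {I : ModelWithCorners ℝ E H} [I.Boundaryless]
  {Q : Type*} [TopologicalSpace Q] [ChartedSpace H Q] [IsManifold I ∞ Q]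
  {G : Type*} [NormedAddCommGroup G] [NormedSpace ℝ G]

/-! ### Derivatives along vector fields and the flat connections of charts -/

theorem mdifferentiableAt_mvfderiv_apply {φ : Q → G} {q : Q} (hφ : ContMDiffAt I 𝓘(ℝ, G) ∞ φ q)
    {X : ∀ q : Q, TangentSpace I q}
    (hX : MDifferentiableAt I (I.prod 𝓘(ℝ, E)) (fun q ↦ TotalSpace.mk' E q (X q)) q) :
    MDifferentiableAt I 𝓘(ℝ, G) (fun q' ↦ mvfderiv I φ q' (X q')) q := by
  have h1 := (hφ.mfderiv_const (m := ∞) (by simp)).mdifferentiableAt (by simp)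
  have h2 := h1.clm_apply_of_inCoordinates (b₁ := id) (b₂ := φ)
    (E₂ := (TangentSpace 𝓘(ℝ, G) : G → Type _)) hX (hφ.mdifferentiableAt (by simp))
  exact ((contMDiff_snd_tangentBundle_modelSpace (n := 1) G 𝓘(ℝ, G)).mdifferentiableAt
    one_ne_zero).comp q h2

/-- The derivative of a vector-valued function maps the Lie bracket of two vector fields to the
commutator of the iterated directional derivatives. In the chart around the point, the second
derivatives of the function cancel by symmetry. -/
theorem mvfderiv_mlieBracket {φ : Q → G} {q : Q} (hφ : ContMDiffAt I 𝓘(ℝ, G) ∞ φ q)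
    {X Y : ∀ q : Q, TangentSpace I q}
    (hX : MDifferentiableAt I (I.prod 𝓘(ℝ, E)) (fun q ↦ TotalSpace.mk' E q (X q)) q)
    (hY : MDifferentiableAt I (I.prod 𝓘(ℝ, E)) (fun q ↦ TotalSpace.mk' E q (Y q)) q) :
    mvfderiv I φ q (VectorField.mlieBracket I X Y q)
      = mvfderiv I (fun q' ↦ mvfderiv I φ q' (Y q')) q (X q)
        - mvfderiv I (fun q' ↦ mvfderiv I φ q' (X q')) q (Y q) := by
  have hr : Set.range I = Set.univ := I.range_eq_univ
  set ψ := extChartAt I q with hψ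
  -- the vector fields and the function read in the chart
  let hat (Z : ∀ q : Q, TangentSpace I q) : E → E :=
    VectorField.mpullbackWithin 𝓘(ℝ, E) I ψ.symm Z (Set.range I)
  have hat_q (Z : ∀ q : Q, TangentSpace I q) : hat Z (ψ q) = Z q := by
    have := mfderivWithin_extChartAt_symm_inverse_apply (I := I) (x := q) (Z q)
    simp only [hat, VectorField.mpullbackWithin, hψ]
    rw [extChartAt_to_inv]
    exact this
  have hat_diff {Z : ∀ q : Q, TangentSpace I q}
      (hZ : MDifferentiableAt I (I.prod 𝓘(ℝ, E)) (fun q ↦ TotalSpace.mk' E q (Z q)) q) :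
      DifferentiableAt ℝ (hat Z) (ψ q) := by
    have := (mdifferentiableWithinAt_univ.2 hZ).differentiableWithinAt_mpullbackWithin_vectorField
    rw [Set.preimage_univ, Set.univ_inter] at this
    exact DifferentiableWithinAt.differentiableAt (this :) (by rw [hr]; exact Filter.univ_mem)
  let φ' : E → G := φ ∘ ψ.symm
  have hφ' : ContDiffAt ℝ ∞ φ' (ψ q) := by
    rw [contMDiffAt_iff] at hφ
    have h2 := hφ.2
    rw [hr, contDiffWithinAt_univ] at h2
    exact h2
  -- the derivative of `φ` along a vector field, read in the chart
  have key {Z : ∀ q : Q, TangentSpace I q}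
      (hZ : MDifferentiableAt I (I.prod 𝓘(ℝ, E)) (fun q ↦ TotalSpace.mk' E q (Z q)) q) (v : E) :
      mvfderiv I (fun q' ↦ mvfderiv I φ q' (Z q')) q v
        = fderiv ℝ (fderiv ℝ φ') (ψ q) v (Z q) + fderiv ℝ φ' (ψ q) (fderiv ℝ (hat Z) (ψ q) v) := by
    have h1 : (fun q' ↦ mvfderiv I φ q' (Z q')) ∘ ψ.symm =ᶠ[𝓝 (ψ q)]
        fun z ↦ fderiv ℝ φ' z (hat Z z) := by
      have hev : ∀ᶠ q' in 𝓝 q, ContMDiffAt I 𝓘(ℝ, G) 1 φ q' :=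
        (contMDiffAt_iff_contMDiffAt_nhds (by simp)).1 (hφ.of_le (mod_cast le_top))
      rw [← extChartAt_to_inv (I := I) q] at hev
      filter_upwards [extChartAt_target_mem_nhds (I := I) q,
        (continuousAt_extChartAt_symm (I := I) q).eventually hev] with z hz hz'
      have hinv := isInvertible_mfderivWithin_extChartAt_symm (I := I) hz
      have hs : HasMFDerivAt 𝓘(ℝ, E) I ψ.symm z (mfderivWithin 𝓘(ℝ, E) I ψ.symm (Set.range I) z) :=
        (mdifferentiableWithinAt_extChartAt_symm hz).hasMFDerivWithinAt.hasMFDerivAt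
          (by rw [hr]; exact Filter.univ_mem)
      let L : E →L[ℝ] G := (mvfderiv I φ (ψ.symm z)).comp
        (mfderivWithin 𝓘(ℝ, E) I ψ.symm (Set.range I) z)
      have hc : HasFDerivAt φ' L z :=
        ((hz'.mdifferentiableAt one_ne_zero).hasMFDerivAt.comp z hs).hasFDerivAt
      have h1 : fderiv ℝ φ' z (hat Z z) = L (hat Z z) := by rw [hc.fderiv]
      have h2 := hinv.self_apply_inverse (Z (ψ.symm z))
      exact (congrArg (mvfderiv I φ (ψ.symm z)) h2).symm.trans h1.symm
    have h2 := (mdifferentiableAt_mvfderiv_apply hφ hZ).mvfderiv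
    rw [h2, hr, fderivWithin_univ]
    have h3 : writtenInExtChartAt I 𝓘(ℝ, G) q (fun q' ↦ mvfderiv I φ q' (Z q'))
      = (fun q' ↦ mvfderiv I φ q' (Z q')) ∘ ψ.symm := rfl
    rw [h3, h1.fderiv_eq]
    have h4 : DifferentiableAt ℝ (fderiv ℝ φ') (ψ q) :=
      (hφ'.fderiv_right (m := ∞) (by simp)).differentiableAt (by simp)
    rw [fderiv_clm_apply h4 (hat_diff hZ)]
    rw [add_comm]
    exact congrArg (fun y ↦ fderiv ℝ (fderiv ℝ φ') (ψ q) v y + _) (hat_q Z)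
  have hbr : VectorField.mlieBracket I X Y q
      = fderiv ℝ (hat Y) (ψ q) (X q) - fderiv ℝ (hat X) (ψ q) (Y q) := by
    rw [← VectorField.mlieBracketWithin_univ, VectorField.mlieBracketWithin_apply,
      mfderiv_extChartAt_self, Set.preimage_univ, Set.univ_inter]
    have h1 : VectorField.lieBracketWithin ℝ (hat X) (hat Y) (Set.range I) (ψ q)
        = fderiv ℝ (hat Y) (ψ q) (X q) - fderiv ℝ (hat X) (ψ q) (Y q) := by
      rw [hr, VectorField.lieBracketWithin_univ, VectorField.lieBracket]
      exact congrArg₂ (fun u v : E ↦ fderiv ℝ (hat Y) (ψ q) u - fderiv ℝ (hat X) (ψ q) v)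
        (hat_q X) (hat_q Y)
    refine .trans ?_ h1
    exact congrArg (fun L : E →L[ℝ] E ↦ L _) (ContinuousLinearMap.inverse_id (R := ℝ) (M := E))
  have hd : mvfderiv I φ q = fderiv ℝ φ' (ψ q) := by
    rw [(hφ.mdifferentiableAt (by simp)).mvfderiv, hr, fderivWithin_univ]
    rfl
  have hsymm : fderiv ℝ (fderiv ℝ φ') (ψ q) (X q) (Y q)
      = fderiv ℝ (fderiv ℝ φ') (ψ q) (Y q) (X q) :=
    (hφ'.isSymmSndFDerivAt (by simpa using WithTop.coe_le_coe.2 (le_top : (2 : ℕ∞) ≤ ⊤))) _ _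
  have h1 : mvfderiv I φ q (VectorField.mlieBracket I X Y q)
      = fderiv ℝ φ' (ψ q) (fderiv ℝ (hat Y) (ψ q) (X q) - fderiv ℝ (hat X) (ψ q) (Y q)) := by
    rw [hbr, hd]
    rfl
  refine h1.trans (.trans ?_ (congrArg₂ (fun u v : G ↦ u - v) (key hY (X q)) (key hX (Y q))).symm)
  rw [hsymm, map_sub, add_sub_add_left_eq_sub]

/-- The flat connection of a chart is a torsion-free connection on the domain of the chart: its
torsion vanishes because the components of the Lie bracket of two vector fields are the
commutators of the derivatives of their components. -/
theorem isTorsionFreeConnectionOn_chartConnection {φ : OpenPartialHomeomorph Q H}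
    (hφ : φ ∈ IsManifold.maximalAtlas I ∞ Q) :
    IsTorsionFreeConnectionOn (I := I) (chartConnection φ) φ.source := by
  have hsm {q : Q} (hq : q ∈ φ.source) : ContMDiffAt I 𝓘(ℝ, E) ∞ (φ.extend I) q :=
    φ.contMDiffAt_extend hφ hq
  -- the differential of the chart is invertible, so that no junk value of `inverse` intervenes
  have hinv {q : Q} (hq : q ∈ φ.source) : (mvfderiv I (φ.extend I) q).IsInvertible := by
    have hd : MDifferentiableAt I 𝓘(ℝ, E) (φ.extend I) q := (hsm hq).mdifferentiableAt (by simp)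
    have hq' : φ.extend I q ∈ (φ.extend I).target := (φ.extend I).map_source (by simpa using hq)
    have hnhds : (φ.extend I).target ∈ 𝓝 (φ.extend I q) := φ.isOpen_extend_target.mem_nhds hq'
    have hs : MDifferentiableAt 𝓘(ℝ, E) I (φ.extend I).symm (φ.extend I q) := by
      refine ((contMDiffOn_extend_symm hφ).contMDiffAt ?_).mdifferentiableAt (by simp)
      rwa [← φ.extend_target']
    have hi : (φ.extend I).symm (φ.extend I q) = q := φ.extend_left_inv hq
    have h1 : mfderiv 𝓘(ℝ, E) 𝓘(ℝ, E) (φ.extend I ∘ (φ.extend I).symm) (φ.extend I q)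
        = ContinuousLinearMap.id ℝ _ := by
      have h : φ.extend I ∘ (φ.extend I).symm =ᶠ[𝓝 (φ.extend I q)] id :=
        Filter.eventually_of_mem hnhds fun z hz ↦ (φ.extend I).right_inv hz
      exact h.mfderiv_eq.trans mfderiv_id
    have h2 : mfderiv I I ((φ.extend I).symm ∘ φ.extend I) q = ContinuousLinearMap.id ℝ _ := by
      have h : (φ.extend I).symm ∘ φ.extend I =ᶠ[𝓝 q] id :=
        Filter.eventually_of_mem (φ.open_source.mem_nhds hq) fun z hz ↦ φ.extend_left_inv hz
      exact h.mfderiv_eq.trans mfderiv_id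
    have h3 := mfderiv_comp_of_eq (x := φ.extend I q) hd hs hi
    rw [hi] at h3
    exact ContinuousLinearMap.IsInvertible.of_inverse
      (g := mfderiv 𝓘(ℝ, E) I (φ.extend I).symm (φ.extend I q))
      (h3.symm.trans h1) ((mfderiv_comp q hs hd).symm.trans h2)
  have hval (Y : ∀ q : Q, TangentSpace I q) (q : Q) (v : TangentSpace I q) :
      chartConnection φ Y q v = (mvfderiv I (φ.extend I) q).inverse
        (mvfderiv I (fun q' ↦ mvfderiv I (φ.extend I) q' (Y q')) q v) := rfl
  refine ⟨φ.open_source, ⟨fun {X Y q} hX hY hq ↦ ?_, fun {X g q} hX hg hq ↦ ?_⟩,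
    fun q hq X Y hX hY ↦ ?_⟩
  · ext v
    have h : (fun q' ↦ mvfderiv I (φ.extend I) q' ((X + Y) q'))
        = (fun q' ↦ mvfderiv I (φ.extend I) q' (X q'))
          + fun q' ↦ mvfderiv I (φ.extend I) q' (Y q') := by
      ext q'; simp
    rw [add_apply, hval, hval, hval, h,
      mvfderiv_add (mdifferentiableAt_mvfderiv_apply (hsm hq) hX)
        (mdifferentiableAt_mvfderiv_apply (hsm hq) hY)]
    simp
  · ext v
    have h : (fun q' ↦ mvfderiv I (φ.extend I) q' ((g • X) q'))
        = g • fun q' ↦ mvfderiv I (φ.extend I) q' (X q') := by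
      ext q'; simp
    rw [hval, h, mvfderiv_smul hg (mdifferentiableAt_mvfderiv_apply (hsm hq) hX)]
    have := (hinv hq).inverse_apply_self (X q)
    refine ((mvfderiv I (φ.extend I) q).inverse.map_add _ _).trans (congrArg₂ (· + ·) ?_ ?_)
    · exact map_smul _ _ _
    · exact (map_smul _ _ _).trans (congrArg (mvfderiv I g q v • ·) this)
  · rw [hval, hval, ← map_sub, ← mvfderiv_mlieBracket (hsm hq) hX hY]
    exact (hinv hq).inverse_apply_self _

end Base

section Horizontal

variable {E : Type*} [NormedAddCommGroup E] [NormedSpace ℝ E]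
  {H : Type*} [TopologicalSpace H] {I : ModelWithCorners ℝ E H}
  {Q : Type*} [TopologicalSpace Q] [ChartedSpace H Q]
  {F : Type*} [NormedAddCommGroup F] [NormedSpace ℝ F]
  {V : Q → Type*} [TopologicalSpace (TotalSpace F V)]
  [∀ q, AddCommGroup (V q)] [∀ q, Module ℝ (V q)] [∀ q, TopologicalSpace (V q)]
  [∀ q, IsTopologicalAddGroup (V q)] [∀ q, ContinuousSMul ℝ (V q)]
  [FiberBundle F V] [VectorBundle ℝ F V]

/-! ### Sections of a dual bundle that are parallel at a point -/

theorem inCoordinates_dualFiber (q₀ q : Q) (β : DualFiber V q) :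
    ContinuousLinearMap.inCoordinates F V ℝ (Trivial Q ℝ) q₀ q q₀ q β
      = (β : V q →L[ℝ] ℝ).comp ((trivializationAt F V q₀).symmL ℝ q) := by
  ext y
  simp [ContinuousLinearMap.inCoordinates]

theorem _root_.Filter.EventuallyEq.mvfderiv_eq {f g : Q → F} {q : Q} (h : f =ᶠ[𝓝 q] g) :
    mvfderiv I f q = mvfderiv I g q :=
  (h.mfderiv_eq (I := I) (I' := 𝓘(ℝ, F)) :)

theorem mvfderiv_clm_apply {G : Type*} [NormedAddCommGroup G] [NormedSpace ℝ G]
    {c : Q → F →L[ℝ] G} {k : Q → F} {q : Q}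
    (hc : MDifferentiableAt I 𝓘(ℝ, F →L[ℝ] G) c q) (hk : MDifferentiableAt I 𝓘(ℝ, F) k q)
    (X : TangentSpace I q) :
    mvfderiv I (fun q' ↦ c q' (k q')) q X
      = mvfderiv I c q X (k q) + c q (mvfderiv I k q X) := by
  have h1 : HasMFDerivAt I 𝓘(ℝ, (F →L[ℝ] G) × F) (fun q' ↦ (c q', k q')) q
      ((mvfderiv I c q).prod (mvfderiv I k q)) :=
    ⟨hc.continuousAt.prodMk hk.continuousAt, hc.hasMFDerivAt.2.prodMk hk.hasMFDerivAt.2⟩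
  have h2 := (isBoundedBilinearMap_apply (𝕜 := ℝ) (E := F) (F := G)).hasFDerivAt (c q, k q)
  have h3 := (h2.hasMFDerivAt.comp q h1).mfderiv
  refine (DFunLike.congr_fun h3 X :).trans ?_
  exact add_comm (c q (mvfderiv I k q X)) (mvfderiv I c q X (k q))

/-- Every element `ν` of a fibre of the dual bundle extends to a section parallel at `q`. In the
trivialization, with `l` the coordinates of `ν`, the section is `l` plus a linear function of the
chart coordinates, whose slope `A` is the difference of `ν ∘ ∇` and the derivative of the
components. This difference is tensorial, so it depends only on the value of the section it is
applied to. -/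
theorem exists_section_parallel_at [IsManifold I ∞ Q] [FiniteDimensional ℝ F]
    [ContMDiffVectorBundle ∞ F V I]
    {cov : (∀ q, V q) → ∀ q : Q, TangentSpace I q →L[ℝ] V q} {U : Set Q}
    (hcov : IsCovariantDerivativeOn F cov U) {q : Q} (hq : q ∈ U) (ν : DualFiber V q) :
    ∃ s : ∀ q, DualFiber V q, s q = ν ∧
      MDifferentiableAt I (I.prod 𝓘(ℝ, F →L[ℝ] ℝ))
        (fun q ↦ TotalSpace.mk' (F →L[ℝ] ℝ) (E := DualFiber V) q (s q)) q ∧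
      ∀ w : ∀ q, V q, MDifferentiableAt I (I.prod 𝓘(ℝ, F)) (fun q ↦ TotalSpace.mk' F q (w q)) q →
        ∀ X, mvfderiv I (fun q' ↦ (s q' (w q') : ℝ)) q X = ν (cov w q X) := by
  set e := trivializationAt F V q with he
  have hqe : q ∈ e.baseSet := mem_baseSet_trivializationAt F V q
  have hbase : e.baseSet ∈ 𝓝 q := e.open_baseSet.mem_nhds hqe
  let ν' : V q →L[ℝ] ℝ := ν
  let l : F →L[ℝ] ℝ := ν'.comp (e.symmL ℝ q)
  -- the difference of `ν ∘ ∇` and the derivative in the trivialization is tensorial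
  let Φ (w : ∀ q, V q) : E →L[ℝ] ℝ :=
    (ν'.comp (cov w q) - mvfderiv I (fun q' ↦ l (e ⟨q', w q'⟩).2) q : TangentSpace I q →L[ℝ] ℝ)
  have hΦ_apply (w : ∀ q, V q) (X : TangentSpace I q) :
      Φ w X = ν' (cov w q X) - mvfderiv I (fun q' ↦ l (e ⟨q', w q'⟩).2) q X := rfl
  have hcoord {w : ∀ q, V q}
      (hw : MDifferentiableAt I (I.prod 𝓘(ℝ, F)) (fun q ↦ TotalSpace.mk' F q (w q)) q) :
      MDifferentiableAt I 𝓘(ℝ, F) (fun q' ↦ (e ⟨q', w q'⟩).2) q :=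
    (mdifferentiableAt_section I w).1 hw
  have hl {w : ∀ q, V q}
      (hw : MDifferentiableAt I (I.prod 𝓘(ℝ, F)) (fun q ↦ TotalSpace.mk' F q (w q)) q) :
      MDifferentiableAt I 𝓘(ℝ) (fun q' ↦ l (e ⟨q', w q'⟩).2) q :=
    l.differentiableAt.mdifferentiableAt.comp q (hcoord hw)
  have hΦ : TensorialAt I F Φ q := by
    refine ⟨fun {f w} hf hw ↦ ?_, fun {w w'} hw hw' ↦ ?_⟩
    · have h : (fun q' ↦ l (e ⟨q', (f • w) q'⟩).2) =ᶠ[𝓝 q] f • fun q' ↦ l (e ⟨q', w q'⟩).2 := by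
        filter_upwards [hbase] with q' hq'
        simp only [Pi.smul_apply', (e.linear ℝ hq').map_smul, map_smul]
      have hlq : l (e ⟨q, w q⟩).2 = ν' (w q) := by
        rw [← e.continuousLinearMapAt_apply_of_mem (R := ℝ) hqe]
        exact congrArg ν' (e.symmL_continuousLinearMapAt hqe (w q))
      refine ContinuousLinearMap.ext fun X : TangentSpace I q ↦ ?_
      have h1 : Φ (f • w) X = f q * (ν' (cov w q X)
          - mvfderiv I (fun q' ↦ l (e ⟨q', w q'⟩).2) q X) := by
        rw [hΦ_apply, h.mvfderiv_eq, mvfderiv_smul hf (hl hw), hcov.leibniz hw hf hq, hlq]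
        simp
        ring
      exact h1
    · have h : (fun q' ↦ l (e ⟨q', (w + w') q'⟩).2) =ᶠ[𝓝 q]
          (fun q' ↦ l (e ⟨q', w q'⟩).2) + fun q' ↦ l (e ⟨q', w' q'⟩).2 := by
        filter_upwards [hbase] with q' hq'
        simp only [Pi.add_apply, (e.linear ℝ hq').map_add, map_add]
      refine ContinuousLinearMap.ext fun X : TangentSpace I q ↦ ?_
      have h1 : Φ (w + w') X = (ν' (cov w q X) - mvfderiv I (fun q' ↦ l (e ⟨q', w q'⟩).2) q X)
          + (ν' (cov w' q X) - mvfderiv I (fun q' ↦ l (e ⟨q', w' q'⟩).2) q X) := by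
        rw [hΦ_apply, h.mvfderiv_eq, mvfderiv_add (hl hw) (hl hw'), hcov.add hw hw' hq]
        simp
        ring
      exact h1
  have hψ : MDifferentiableAt I 𝓘(ℝ, E) (extChartAt I q) q :=
    mdifferentiableAt_extChartAt (mem_chart_source H q)
  let A : V q →L[ℝ] E →L[ℝ] ℝ := TensorialAt.mkHom Φ q hΦ
  let c (q' : Q) : F →L[ℝ] ℝ :=
    l + (A.comp (e.symmL ℝ q)).flip (extChartAt I q q' - extChartAt I q q)
  have hc : MDifferentiableAt I 𝓘(ℝ, F →L[ℝ] ℝ) c q := by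
    have h1 : Differentiable ℝ fun z : E ↦
        l + (A.comp (e.symmL ℝ q)).flip (z - extChartAt I q q) := by fun_prop
    exact h1.differentiableAt.mdifferentiableAt.comp q hψ
  have hcq : c q = l := by simp [c]
  have hdc (X : TangentSpace I q) : mvfderiv I c q X = (A.comp (e.symmL ℝ q)).flip X := by
    let L := (A.comp (e.symmL ℝ q)).flip
    have h1 : HasFDerivAt (fun z : E ↦ l + L (z - extChartAt I q q)) L (extChartAt I q q) :=
      (L.hasFDerivAt.comp _ ((hasFDerivAt_id _).sub_const _)).const_add l
    have h2 := (h1.hasMFDerivAt.comp q hψ.hasMFDerivAt).mfderiv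
    rw [mfderiv_extChartAt_self] at h2
    exact DFunLike.congr_fun h2 X
  refine ⟨fun q' ↦ (c q').comp (e.continuousLinearMapAt ℝ q'), ?_, ?_, fun w hw X ↦ ?_⟩
  · ext v
    simp only [hcq]
    exact congrArg ν' (e.symmL_continuousLinearMapAt hqe v)
  · rw [mdifferentiableAt_hom_bundle]
    refine ⟨mdifferentiableAt_id, hc.congr_of_eventuallyEq ?_⟩
    filter_upwards [hbase] with q' hq'
    rw [inCoordinates_dualFiber]
    ext y
    exact congrArg (c q') (e.continuousLinearMapAt_symmL hq' y)
  · have h : (fun q' ↦ (c q').comp (e.continuousLinearMapAt ℝ q') (w q'))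
        =ᶠ[𝓝 q] fun q' ↦ c q' (e ⟨q', w q'⟩).2 := by
      filter_upwards [hbase] with q' hq'
      simp [e.continuousLinearMapAt_apply_of_mem (R := ℝ) hq']
    refine (congrArg (fun L ↦ L X) h.mvfderiv_eq).trans ?_
    rw [mvfderiv_clm_apply hc (hcoord hw), hdc, hcq]
    have h1 : A (w q) = Φ w := TensorialAt.mkHom_apply hΦ hw
    have h2 : A (e.symmL ℝ q (e ⟨q, w q⟩).2) X = Φ w X := by
      rw [← h1, ← e.continuousLinearMapAt_apply_of_mem (R := ℝ) hqe,
        e.symmL_continuousLinearMapAt hqe]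
    refine (congrArg (· + _) (h2.trans (hΦ_apply w X))).trans ?_
    have h3 : l (mvfderiv I (fun q' ↦ (e ⟨q', w q'⟩).2) q X)
        = mvfderiv I (fun q' ↦ l (e ⟨q', w q'⟩).2) q X := by
      have h4 := (l.hasFDerivAt.hasMFDerivAt.comp q (hcoord hw).hasMFDerivAt).mfderiv
      exact (DFunLike.congr_fun h4 X).symm
    rw [h3]
    exact sub_add_cancel _ _

theorem exists_isHorizontalSection [IsManifold I ∞ Q] [FiniteDimensional ℝ E]
    [FiniteDimensional ℝ F] [ContMDiffVectorBundle ∞ F V I]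
    {cov : (∀ q : Q, TangentSpace I q) → ∀ q : Q, TangentSpace I q →L[ℝ] TangentSpace I q}
    {U : Set Q} (hcov : IsCovariantDerivativeOn E cov U) (nabla : CovariantDerivative I F V)
    (x : LPDual I F V) (hx : x.proj ∈ U) :
    ∃ s, IsHorizontalSection cov nabla x s := by
  obtain ⟨s₁, h₁, hd₁, hp₁⟩ := exists_section_parallel_at hcov hx x.2.1
  obtain ⟨s₂, h₂, hd₂, hp₂⟩ := exists_section_parallel_at
    (nabla.isCovariantDerivativeOn (s := Set.univ)) (Set.mem_univ x.proj) x.2.2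
  refine ⟨fun q ↦ (s₁ q, s₂ q), Prod.ext h₁ h₂, ?_, hp₁, hp₂⟩
  rw [mdifferentiableAt_totalSpace] at hd₁ hd₂ ⊢
  exact ⟨mdifferentiableAt_id, hd₁.2.prodMk_space hd₂.2⟩

end Horizontal

/-! ### Local coordinates given by affine functions -/

theorem sum_clm_smul_coord {ι G : Type*} [Fintype ι] [NormedAddCommGroup G] [NormedSpace ℝ G]
    [FiniteDimensional ℝ G] (b : Module.Basis ι ℝ G) (l : G →L[ℝ] ℝ) :
    ∑ i, l (b i) • (b.coord i).toContinuousLinearMap = l := by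
  refine ContinuousLinearMap.coe_injective (b.ext fun j ↦ ?_)
  classical simp [Finsupp.single_apply]

section Evaluation

variable {E : Type*} [NormedAddCommGroup E] [NormedSpace ℝ E]
  {H : Type*} [TopologicalSpace H] {I : ModelWithCorners ℝ E H}
  {Q : Type*} [TopologicalSpace Q] [ChartedSpace H Q] [IsManifold I ∞ Q]
  {F : Type*} [NormedAddCommGroup F] [NormedSpace ℝ F]
  {V : Q → Type*} [TopologicalSpace (TotalSpace F V)]
  [∀ q, AddCommGroup (V q)] [∀ q, Module ℝ (V q)] [∀ q, TopologicalSpace (V q)]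
  [∀ q, IsTopologicalAddGroup (V q)] [∀ q, ContinuousSMul ℝ (V q)]
  [FiberBundle F V] [VectorBundle ℝ F V]

theorem pullback_apply (f : C^∞⟮I, Q; 𝓘(ℝ), ℝ⟯) (x : LPDual I F V) :
    pullback F V f x = f x.proj := rfl

theorem linear_apply (X : Cₛ^∞⟮I; E, (TangentSpace I : Q → Type _)⟯) (w : Cₛ^∞⟮I; F, V⟯)
    (x : LPDual I F V) : linear X w x = x.2.1 (X x.proj) + x.2.2 (w x.proj) := rfl

theorem localFrame_eq_symmL {ι : Type*} (b : Module.Basis ι ℝ F)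
    (e : Trivialization F (TotalSpace.proj : TotalSpace F V → Q)) [MemTrivializationAtlas e]
    {q : Q} (hq : q ∈ e.baseSet) (i : ι) : e.localFrame b i q = e.symmL ℝ q (b i) := by
  rw [e.localFrame_apply_of_mem_baseSet b hq, Trivialization.basisAt, Module.Basis.map_apply,
    Trivialization.symmL_apply _ hq]
  rfl

end Evaluation

section Coordinates

variable {E : Type*} [NormedAddCommGroup E] [NormedSpace ℝ E] [FiniteDimensional ℝ E]
  {H : Type*} [TopologicalSpace H] {I : ModelWithCorners ℝ E H} [I.Boundaryless]
  {Q : Type*} [TopologicalSpace Q] [ChartedSpace H Q] [IsManifold I ∞ Q] [T2Space Q]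
  {F : Type*} [NormedAddCommGroup F] [NormedSpace ℝ F] [FiniteDimensional ℝ F]
  {V : Q → Type*} [TopologicalSpace (TotalSpace F V)]
  [∀ q, AddCommGroup (V q)] [∀ q, Module ℝ (V q)] [∀ q, TopologicalSpace (V q)]
  [∀ q, IsTopologicalAddGroup (V q)] [∀ q, ContinuousSMul ℝ (V q)]
  [FiberBundle F V] [VectorBundle ℝ F V] [ContMDiffVectorBundle ∞ F V I]

/-- A function on `T*Q ⊕ V*` is affine if it is the pullback of a function on `Q` or the fibrewise
linear function of a section of `TQ ⊕ V`. -/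
def IsAffine (a : DualAlgebra I F V) : Prop :=
  (∃ f, a = pullback F V f) ∨ ∃ X w, a = linear X w

set_option maxHeartbeats 1000000 in
/-- Near every fibre, all smooth functions on `T*Q ⊕ V*` are smooth functions of finitely many
affine functions: cut-off coordinates of a chart and the linear functions of cut-off local frames
of `TQ` and `V`. -/
theorem exists_affine_coordinates (q₀ : Q) :
    ∃ (ι : Type) (_ : Fintype ι) (u : ι → DualAlgebra I F V), (∀ i, IsAffine (u i)) ∧
      ∃ W ∈ 𝓝 q₀, ∀ f : DualAlgebra I F V, ∃ G : (ι → ℝ) → ℝ, ContDiff ℝ ∞ G ∧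
        ∀ x : LPDual I F V, x.proj ∈ W → f x = G (fun i ↦ u i x) := by
  let bE := Module.finBasis ℝ E
  let bF := Module.finBasis ℝ F
  let eT := trivializationAt E (TangentSpace I : Q → Type _) q₀
  let eV := trivializationAt F V q₀
  let φ := extChartAt I q₀
  let O := (chartAt H q₀).source ∩ eV.baseSet
  have hO : IsOpen O := (chartAt H q₀).open_source.inter eV.open_baseSet
  have hq₀ : q₀ ∈ O := ⟨mem_chart_source H q₀, mem_baseSet_trivializationAt F V q₀⟩
  have hOT : O ⊆ eT.baseSet := Set.inter_subset_left.trans (by simp [eT])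
  obtain ⟨χ, -, hχ⟩ := (SmoothBumpFunction.nhds_basis_tsupport (I := I) q₀).mem_iff.1
    (hO.mem_nhds hq₀)
  -- the coordinate functions and the local frames, cut off by `χ`
  let cutCoord (i) : C^∞⟮I, Q; 𝓘(ℝ), ℝ⟯ := ⟨fun q ↦ χ q • bE.coord i (φ q), by
    refine χ.contMDiff_smul ?_
    exact ((bE.coord i).toContinuousLinearMap.contMDiff (n := ∞)).comp_contMDiffOn
      contMDiffOn_extChartAt⟩
  let cutT (i) : Cₛ^∞⟮I; E, (TangentSpace I : Q → Type _)⟯ := ⟨(⇑χ : Q → ℝ) • eT.localFrame bE i,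
    ContMDiffOn.smul_section_of_tsupport χ.contMDiff.contMDiffOn eT.open_baseSet (hχ.trans hOT)
      (eT.contMDiffOn_localFrame_baseSet ∞ bE i)⟩
  let cutV (j) : Cₛ^∞⟮I; F, V⟯ := ⟨(⇑χ : Q → ℝ) • eV.localFrame bF j,
    ContMDiffOn.smul_section_of_tsupport χ.contMDiff.contMDiffOn eV.open_baseSet
      (hχ.trans Set.inter_subset_right) (eV.contMDiffOn_localFrame_baseSet ∞ bF j)⟩
  -- the same neighbourhood, seen in the chart
  obtain ⟨ρ, hρ⟩ : ∃ ρ : ContDiffBump (φ q₀),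
      Metric.closedBall (φ q₀) ρ.rOut ⊆ φ.target ∩ φ.symm ⁻¹' O := by
    have h : φ.target ∩ φ.symm ⁻¹' O ∈ 𝓝 (φ q₀) :=
      Filter.inter_mem (extChartAt_target_mem_nhds q₀)
        (((continuousAt_extChartAt_symm q₀).preimage_mem_nhds
          (by rw [extChartAt_to_inv]; exact hO.mem_nhds hq₀)))
    obtain ⟨r, hr, hball⟩ := Metric.nhds_basis_closedBall.mem_iff.1 h
    exact ⟨⟨r / 2, r, half_pos hr, half_lt_self hr⟩, hball⟩
  let ψ := extChartAt (dualModel I F) (⟨q₀, 0⟩ : LPDual I F V)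
  have hbase {q : Q} : q ∈ (trivializationAt ((E →L[ℝ] ℝ) × (F →L[ℝ] ℝ))
      (CotangentFiber I (Q := Q) ×ᵇ DualFiber V) q₀).baseSet ↔ q ∈ O := by
    have h : (trivializationAt ((E →L[ℝ] ℝ) × (F →L[ℝ] ℝ))
      (CotangentFiber I (Q := Q) ×ᵇ DualFiber V) q₀).baseSet
        = (eT.baseSet ∩ Set.univ) ∩ (eV.baseSet ∩ Set.univ) := rfl
    rw [h, Set.inter_univ, Set.inter_univ]
    exact Iff.rfl
  have hψ_target : ψ.target = (φ.target ∩ φ.symm ⁻¹' O) ×ˢ Set.univ := by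
    refine (FiberBundle.extChartAt_target _).trans ?_
    congr 1
    ext z
    refine ⟨fun ⟨h1, h2⟩ ↦ ⟨h1, ?_⟩, fun ⟨h1, h2⟩ ↦ ⟨h1, hbase.2 h2⟩⟩
    exact hbase.1 h2
  have hψ (x : LPDual I F V) (hx : x.proj ∈ O) : x ∈ ψ.source ∧ ψ x
      = (φ x.proj, (x.2.1 : TangentSpace I x.proj →L[ℝ] ℝ).comp (eT.symmL ℝ x.proj),
        (x.2.2 : V x.proj →L[ℝ] ℝ).comp (eV.symmL ℝ x.proj)) := by
    constructor
    · have h1 : ψ = _ := FiberBundle.extChartAt _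
      rw [h1]
      refine ⟨(Bundle.Trivialization.mem_source _).2 (hbase.2 hx), ?_, Set.mem_univ _⟩
      exact (extChartAt_source (I := I) q₀).symm ▸ hx.1
    · refine Prod.ext rfl (Prod.ext ?_ ?_)
      · exact inCoordinates_dualFiber (F := E) (V := (TangentSpace I : Q → Type _)) q₀ x.proj x.2.1
      · exact inCoordinates_dualFiber (F := F) (V := V) q₀ x.proj x.2.2
  -- the point of the model space with given coordinates
  let L (y : Fin _ ⊕ Fin _ ⊕ Fin _ → ℝ) : E × (E →L[ℝ] ℝ) × (F →L[ℝ] ℝ) :=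
    (∑ i, y (.inl i) • bE i, ∑ i, y (.inr (.inl i)) • (bE.coord i).toContinuousLinearMap,
      ∑ j, y (.inr (.inr j)) • (bF.coord j).toContinuousLinearMap)
  have hL : ContDiff ℝ ∞ L := by fun_prop
  refine ⟨_, inferInstance, Sum.elim (fun i ↦ pullback F V (cutCoord i))
    (Sum.elim (fun i ↦ linear (cutT i) 0) fun j ↦ linear 0 (cutV j)), ?_,
    {q | q ∈ O ∧ χ q = 1 ∧ ρ (φ q) = 1}, ?_, fun f ↦
      ⟨fun y ↦ ρ (L y).1 * f (ψ.symm (L y)), ?_, fun x hx ↦ ?_⟩⟩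
  · rintro (i | i | j)
    exacts [.inl ⟨_, rfl⟩, .inr ⟨_, _, rfl⟩, .inr ⟨_, _, rfl⟩]
  · have h1 : ∀ᶠ q in 𝓝 q₀, ρ (φ q) = 1 :=
      (continuousAt_extChartAt (I := I) q₀).eventually ρ.eventuallyEq_one
    filter_upwards [hO.mem_nhds hq₀, χ.eventuallyEq_one, h1] with q h2 h3 h4 using ⟨h2, h3, h4⟩
  · suffices h : ContDiff ℝ ∞ fun z : E × (E →L[ℝ] ℝ) × (F →L[ℝ] ℝ) ↦ ρ z.1 * f (ψ.symm z) from
      h.comp hL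
    refine contDiff_iff_contDiffAt.2 fun z ↦ ?_
    by_cases hz : z.1 ∈ Metric.closedBall (φ q₀) ρ.rOut
    · have hzt : z ∈ ψ.target := by
        rw [hψ_target]
        exact ⟨hρ hz, Set.mem_univ _⟩
      refine (ρ.contDiff.contDiffAt.comp z contDiffAt_fst).mul ?_
      have h1 : ContMDiffOn 𝓘(ℝ, E × (E →L[ℝ] ℝ) × (F →L[ℝ] ℝ)) 𝓘(ℝ) ∞ (f ∘ ψ.symm) ψ.target :=
        f.contMDiff.comp_contMDiffOn (contMDiffOn_extChartAt_symm _)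
      exact (h1.contMDiffAt ((isOpen_extChartAt_target _).mem_nhds hzt)).contDiffAt
    · have h1 : (fun z : E × (E →L[ℝ] ℝ) × (F →L[ℝ] ℝ) ↦ ρ z.1 * f (ψ.symm z)) =ᶠ[𝓝 z]
          fun _ ↦ 0 := by
        filter_upwards [(Metric.isClosed_closedBall.isOpen_compl.preimage
          continuous_fst).mem_nhds hz] with z' hz'
        rw [ρ.zero_of_le_dist (not_le.1 fun h ↦ hz' h).le, zero_mul]
      exact contDiffAt_const.congr_of_eventuallyEq h1
  · obtain ⟨hxO, hχx, hρx⟩ := hx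
    obtain ⟨hxs, hxe⟩ := hψ x hxO
    have hLx : L (fun i ↦ Sum.elim (fun i ↦ pullback F V (cutCoord i))
        (Sum.elim (fun i ↦ linear (cutT i) 0) fun j ↦ linear 0 (cutV j)) i x) = ψ x := by
      rw [hxe]
      refine Prod.ext ?_ (Prod.ext ?_ ?_)
      · simp only [L, Sum.elim_inl, pullback_apply]
        refine (Finset.sum_congr rfl fun i _ ↦ ?_).trans (bE.sum_repr (φ x.proj))
        change (χ x.proj • bE.coord i (φ x.proj)) • bE i = _
        rw [hχx, one_smul]
        rfl
      · simp only [L, Sum.elim_inl, Sum.elim_inr, linear_apply]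
        refine (Finset.sum_congr rfl fun i _ ↦ ?_).trans (sum_clm_smul_coord bE
          ((x.2.1 : TangentSpace I x.proj →L[ℝ] ℝ).comp (eT.symmL ℝ x.proj)))
        congr 1
        change x.2.1 (χ x.proj • eT.localFrame bE i x.proj) + x.2.2 0 = _
        rw [hχx, one_smul, map_zero, add_zero, localFrame_eq_symmL bE eT (hOT hxO)]
        rfl
      · simp only [L, Sum.elim_inr, linear_apply]
        refine (Finset.sum_congr rfl fun i _ ↦ ?_).trans (sum_clm_smul_coord bF
          ((x.2.2 : V x.proj →L[ℝ] ℝ).comp (eV.symmL ℝ x.proj)))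
        congr 1
        change x.2.1 0 + x.2.2 (χ x.proj • eV.localFrame bF i x.proj) = _
        rw [hχx, one_smul, map_zero, zero_add, localFrame_eq_symmL bF eV hxO.2]
        rfl
    beta_reduce
    rw [hLx, ψ.left_inv hxs, hxe, hρx, one_mul]

end Coordinates

/-! ### Derivations vanishing on affine functions -/

/-- If a derivation `D` kills `c` and the `u i`, then `D f` vanishes at every point where `c = 1`
and around which (as the factor `c` expresses) `f` minus its value is a combination of the
differences of the `u i` and their values. -/
theorem eval_derivation_eq_zero {A ι : Type*} [CommRing A] [Algebra ℝ A] [Fintype ι]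
    (D : Derivation ℝ A A) (ev : A →ₐ[ℝ] ℝ) {c f : A} {u g : ι → A} (hc : ev c = 1)
    (h : c * (f - algebraMap ℝ A (ev f)) = c * ∑ i, (u i - algebraMap ℝ A (ev (u i))) * g i)
    (hDc : D c = 0) (hDu : ∀ i, D (u i) = 0) : ev (D f) = 0 := by
  have h1 := congrArg (fun a ↦ ev (D a)) h
  simpa [hDc, hDu, hc] using h1

section Derivation

variable {E : Type*} [NormedAddCommGroup E] [NormedSpace ℝ E] [FiniteDimensional ℝ E]
  {H : Type*} [TopologicalSpace H] {I : ModelWithCorners ℝ E H} [I.Boundaryless]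
  {Q : Type*} [TopologicalSpace Q] [ChartedSpace H Q] [IsManifold I ∞ Q] [T2Space Q]
  {F : Type*} [NormedAddCommGroup F] [NormedSpace ℝ F] [FiniteDimensional ℝ F]
  {V : Q → Type*} [TopologicalSpace (TotalSpace F V)]
  [∀ q, AddCommGroup (V q)] [∀ q, Module ℝ (V q)] [∀ q, TopologicalSpace (V q)]
  [∀ q, IsTopologicalAddGroup (V q)] [∀ q, ContinuousSMul ℝ (V q)]
  [FiberBundle F V] [VectorBundle ℝ F V] [ContMDiffVectorBundle ∞ F V I]

/-- A smooth function of finitely many elements of `C^∞(T*Q ⊕ V*)`. -/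
def compSmooth {ι : Type} [Fintype ι] {G : (ι → ℝ) → ℝ} (hG : ContDiff ℝ ∞ G)
    (u : ι → DualAlgebra I F V) : DualAlgebra I F V :=
  ⟨fun x ↦ G fun i ↦ u i x, hG.contMDiff.comp (contMDiff_pi_space.2 fun i ↦ (u i).contMDiff)⟩

/-- Evaluation of a smooth function at a point, as an algebra homomorphism. -/
def evalAt (x : LPDual I F V) : DualAlgebra I F V →ₐ[ℝ] ℝ :=
  (Pi.evalAlgHom ℝ (fun _ : LPDual I F V ↦ ℝ) x).comp ContMDiffMap.coeFnAlgHom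

/-- A derivation is determined by its values on affine functions: by locality (multiplication by a
bump function), Hadamard's lemma and the local coordinates above. -/
theorem derivation_eq_zero (D : Derivation ℝ (DualAlgebra I F V) (DualAlgebra I F V))
    (hD : ∀ a, IsAffine a → D a = 0) : D = 0 := by
  ext f x
  obtain ⟨ι, _, u, hu, W, hW, h⟩ := exists_affine_coordinates (I := I) (F := F) (V := V) x.proj
  obtain ⟨G, hG, hfG⟩ := h f
  obtain ⟨g, hg, hGg⟩ := exists_contDiff_sub_eq_sum hG (fun i ↦ u i x)
  obtain ⟨χ, -, hχ⟩ := (SmoothBumpFunction.nhds_basis_tsupport (I := I) x.proj).mem_iff.1 hW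
  let c : DualAlgebra I F V := pullback F V ⟨χ, χ.contMDiff⟩
  refine eval_derivation_eq_zero D (evalAt x) (c := c) (u := u)
    (g := fun i ↦ compSmooth (hg i) u) χ.eq_one ?_ (hD _ (.inl ⟨_, rfl⟩)) fun i ↦ hD _ (hu i)
  ext y
  have hsum : (∑ i, (u i - algebraMap ℝ _ (u i x)) * compSmooth (hg i) u) y
      = ∑ i, (u i y - u i x) * g i fun i ↦ u i y := map_sum (evalAt y) _ _
  change χ y.proj * (f y - f x)
    = χ y.proj * (∑ i, (u i - algebraMap ℝ _ (u i x)) * compSmooth (hg i) u) y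
  by_cases hy : y.proj ∈ W
  · rw [hsum, hfG y hy, hfG x (mem_of_mem_nhds hW), hGg]
  · rw [image_eq_zero_of_notMem_tsupport fun h ↦ hy (hχ h), zero_mul, zero_mul]

end Derivation

/-! ### Brackets determined by generators -/

section Generators

variable {A : Type*} [CommRing A] [Algebra ℝ A] {B B' : A →ₗ[ℝ] A →ₗ[ℝ] A} {p : A → Prop}

/-- The derivation `{a, ·}` of an operation `{·, ·}` satisfying the Leibniz identity. -/
def hamiltonianDerivation (hB : ∀ a b c, B a (b * c) = B a b * c + b * B a c) (a : A) :
    Derivation ℝ A A :=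
  Derivation.mk' (B a) fun b c ↦ by rw [hB, smul_eq_mul, smul_eq_mul]; ring

theorem hamiltonianDerivation_apply (hB : ∀ a b c, B a (b * c) = B a b * c + b * B a c) (a b : A) :
    hamiltonianDerivation hB a b = B a b := rfl

/-- Two brackets that agree on generators are equal: the difference of the two derivations `{a, ·}`
kills the generators if `a` is one, and then, by antisymmetry, for every `a`. -/
theorem eq_of_forall_derivation (hp : ∀ D : Derivation ℝ A A, (∀ a, p a → D a = 0) → D = 0)
    (hB : ∀ a b c, B a (b * c) = B a b * c + b * B a c) (halt : ∀ a, B a a = 0)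
    (hB' : ∀ a b c, B' a (b * c) = B' a b * c + b * B' a c) (halt' : ∀ a, B' a a = 0)
    (h : ∀ a b, p a → p b → B a b = B' a b) : B = B' := by
  have key (a) (ha : ∀ b, p b → B a b = B' a b) (b) : B a b = B' a b := by
    have h1 := hp (hamiltonianDerivation hB a - hamiltonianDerivation hB' a) fun b hb ↦ by
      simp [hamiltonianDerivation_apply, ha b hb]
    have h2 := DFunLike.congr_fun h1 b
    simpa [hamiltonianDerivation_apply, sub_eq_zero] using h2
  refine LinearMap.ext₂ fun a b ↦ key a (fun b hb ↦ ?_) b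
  have hs := LinearMap.IsAlt.neg (B := B) halt a b
  have hs' := LinearMap.IsAlt.neg (B := B') halt' a b
  rw [← neg_inj, hs, hs', key b (fun c hc ↦ h b c hb hc)]

/-- The Jacobi identity propagates from generators, since the Jacobiator is a derivation in each
argument: it is `⁅{a, ·}, {b, ·}⁆ - {{a, b}, ·}` as a function of the last one, and invariant under
cyclic permutations. -/
theorem jacobi_of_forall_derivation
    (hp : ∀ D : Derivation ℝ A A, (∀ a, p a → D a = 0) → D = 0)
    (hB : ∀ a b c, B a (b * c) = B a b * c + b * B a c) (halt : ∀ a, B a a = 0)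
    (h : ∀ a b c, p a → p b → p c → B a (B b c) + B b (B c a) + B c (B a b) = 0) (a b c : A) :
    B a (B b c) + B b (B c a) + B c (B a b) = 0 := by
  have hs (a b) : B a b = -B b a := (LinearMap.IsAlt.neg (B := B) halt b a).symm
  have key (a b) (hab : ∀ c, p c → B a (B b c) + B b (B c a) + B c (B a b) = 0) (c) :
      B a (B b c) + B b (B c a) + B c (B a b) = 0 := by
    let D := ⁅hamiltonianDerivation hB a, hamiltonianDerivation hB b⁆
      - hamiltonianDerivation hB (B a b)
    have hD (c) : D c = B a (B b c) + B b (B c a) + B c (B a b) := by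
      simp only [D, Derivation.sub_apply, Derivation.commutator_apply, hamiltonianDerivation_apply]
      rw [hs c a, hs c (B a b), map_neg]
      abel
    have h1 := hp D fun c hc ↦ (hD c).trans (hab c hc)
    rw [← hD, h1, Derivation.zero_apply]
  have hcyc (a b c) : B a (B b c) + B b (B c a) + B c (B a b)
      = B b (B c a) + B c (B a b) + B a (B b c) := by abel
  have h1 (a b c) (ha : p a) (hb : p b) : B a (B b c) + B b (B c a) + B c (B a b) = 0 :=
    key a b (fun c hc ↦ h a b c ha hb hc) c
  have h2 (a b c) (ha : p a) : B a (B b c) + B b (B c a) + B c (B a b) = 0 := by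
    rw [← hcyc]
    refine key c a (fun b hb ↦ ?_) b
    rw [hcyc]
    exact h1 a b c ha hb
  refine key a b (fun c hc ↦ ?_) c
  rw [← hcyc]
  exact h2 c a b hc

end Generators

/-! ### Partial derivatives and the chain rule -/

theorem eq_of_forall_clm_apply_eq {F V : Type*} [NormedAddCommGroup F] [NormedSpace ℝ F]
    [AddCommGroup V] [Module ℝ V] [TopologicalSpace V] (e : V ≃L[ℝ] F) {v w : V}
    (h : ∀ β : V →L[ℝ] ℝ, β v = β w) : v = w :=
  e.injective ((SeparatingDual.eq_iff_forall_dual_eq (R := ℝ)).2 fun l ↦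
    h (l.comp (e : V →L[ℝ] F)))

section Fibre

variable {E : Type*} [NormedAddCommGroup E] [NormedSpace ℝ E]
  {H : Type*} [TopologicalSpace H] {I : ModelWithCorners ℝ E H}
  {Q : Type*} [TopologicalSpace Q] [ChartedSpace H Q] [IsManifold I ∞ Q]
  {F : Type*} [NormedAddCommGroup F] [NormedSpace ℝ F]
  {V : Q → Type*} [TopologicalSpace (TotalSpace F V)]
  [∀ q, AddCommGroup (V q)] [∀ q, Module ℝ (V q)] [∀ q, TopologicalSpace (V q)]
  [∀ q, IsTopologicalAddGroup (V q)] [∀ q, ContinuousSMul ℝ (V q)]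
  [FiberBundle F V] [VectorBundle ℝ F V]

/-- The vectors `ξ ∈ T_qQ` and `v ∈ V_q` represent the derivative of `f` along the fibre through
`x`. -/
def HasFiberDeriv (f : LPDual I F V → ℝ) (x : LPDual I F V) (ξ : TangentSpace I x.proj)
    (v : V x.proj) : Prop :=
  ∀ (α : CotangentFiber I x.proj) (β : DualFiber V x.proj),
    HasLineDerivAt ℝ (fun t : CotangentFiber I x.proj × DualFiber V x.proj ↦ f ⟨x.proj, t⟩)
      (α ξ + β v) x.2 (α, β)

variable {f : LPDual I F V → ℝ} {x : LPDual I F V} {ξ : TangentSpace I x.proj} {v : V x.proj}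

theorem HasFiberDeriv.derivP_eq (h : HasFiberDeriv f x ξ v) : derivP f x = ξ := by
  have h1 : ∀ α : CotangentFiber I x.proj,
    α ξ = lineDeriv ℝ (fun t : CotangentFiber I x.proj × DualFiber V x.proj ↦ f ⟨x.proj, t⟩)
      x.2 (α, 0) := fun α ↦ by simpa using (h α 0).lineDeriv.symm
  refine eq_of_forall_clm_apply_eq (V := TangentSpace I x.proj) (ContinuousLinearEquiv.refl ℝ E)
    fun α ↦ .trans ?_ (h1 α).symm
  exact Classical.epsilon_spec (p := fun ξ ↦ ∀ α : CotangentFiber I x.proj, α ξ = lineDeriv ℝ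
    (fun t : CotangentFiber I x.proj × DualFiber V x.proj ↦ f ⟨x.proj, t⟩) x.2 (α, 0)) ⟨ξ, h1⟩ α

theorem HasFiberDeriv.derivNu_eq (h : HasFiberDeriv f x ξ v) : derivNu f x = v := by
  have h1 : ∀ β : DualFiber V x.proj,
    β v = lineDeriv ℝ (fun t : CotangentFiber I x.proj × DualFiber V x.proj ↦ f ⟨x.proj, t⟩)
      x.2 (0, β) := fun β ↦ by simpa using (h 0 β).lineDeriv.symm
  refine eq_of_forall_clm_apply_eq ((trivializationAt F V x.proj).continuousLinearEquivAt ℝ x.proj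
    (mem_baseSet_trivializationAt F V x.proj)) fun β ↦ ?_
  rw [h1]
  exact Classical.epsilon_spec (p := fun v ↦ ∀ β : DualFiber V x.proj, β v = lineDeriv ℝ
    (fun t : CotangentFiber I x.proj × DualFiber V x.proj ↦ f ⟨x.proj, t⟩) x.2 (0, β)) ⟨v, h1⟩ β

theorem hasFiberDeriv_pullback (h : C^∞⟮I, Q; 𝓘(ℝ), ℝ⟯) : HasFiberDeriv (pullback F V h) x 0 0 := by
  intro α β
  simp only [HasLineDerivAt, pullback_apply, map_zero, add_zero]
  exact hasDerivAt_const _ _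

theorem hasFiberDeriv_linear (X : Cₛ^∞⟮I; E, (TangentSpace I : Q → Type _)⟯) (w : Cₛ^∞⟮I; F, V⟯) :
    HasFiberDeriv (linear X w) x (X x.proj) (w x.proj) := by
  intro α β
  have h1 (a b : ℝ) : HasDerivAt (fun t : ℝ ↦ a + t * b) b 0 := by
    simpa using ((hasDerivAt_id (0 : ℝ)).mul_const b).const_add a
  refine (h1 (x.2.1 (X x.proj) + x.2.2 (w x.proj)) _).congr_of_eventuallyEq (.of_forall fun t ↦ ?_)
  change (x.2.1 (X x.proj) + t * α (X x.proj)) + (x.2.2 (w x.proj) + t * β (w x.proj)) = _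
  ring

/-- The chain rule along a fibre. -/
theorem HasFiberDeriv.comp_pi {ι : Type*} [Fintype ι] [DecidableEq ι] {u : ι → LPDual I F V → ℝ}
    {ξ : ι → TangentSpace I x.proj} {v : ι → V x.proj} {G : (ι → ℝ) → ℝ} {G' : (ι → ℝ) →L[ℝ] ℝ}
    (hu : ∀ i, HasFiberDeriv (u i) x (ξ i) (v i)) (hG : HasFDerivAt G G' fun i ↦ u i x)
    (hf : ∀ y, y.proj = x.proj → f y = G fun i ↦ u i y) :
    HasFiberDeriv f x (∑ i, G' (Pi.single i 1) • ξ i) (∑ i, G' (Pi.single i 1) • v i) := by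
  intro α β
  have hγ : HasDerivAt (fun (t : ℝ) i ↦ u i ⟨x.proj, x.2 + t • (α, β)⟩)
      (fun i ↦ α (ξ i) + β (v i)) 0 := hasDerivAt_pi.2 fun i ↦ hu i α β
  have h0 : (fun i ↦ u i x) = fun i ↦ u i ⟨x.proj, x.2 + (0 : ℝ) • (α, β)⟩ := by
    simp only [zero_smul, add_zero]
  have h1 := (hG.comp_hasDerivAt_of_eq 0 hγ h0).congr_of_eventuallyEq
    (f₁ := fun t : ℝ ↦ f ⟨x.proj, x.2 + t • (α, β)⟩) (.of_forall fun t ↦ hf _ rfl)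
  refine HasDerivAt.congr_deriv h1 ?_
  have h2 : (fun i ↦ α (ξ i) + β (v i)) = ∑ i, (α (ξ i) + β (v i)) • Pi.single i (1 : ℝ) :=
    pi_eq_sum_univ' _
  rw [h2]
  simp only [map_sum, map_smul, smul_eq_mul, ← Finset.sum_add_distrib]
  refine Finset.sum_congr rfl fun i _ ↦ ?_
  ring

end Fibre

section Differential

variable {E : Type*} [NormedAddCommGroup E] [NormedSpace ℝ E] [FiniteDimensional ℝ E]
  {H : Type*} [TopologicalSpace H] {I : ModelWithCorners ℝ E H} [I.Boundaryless]
  {Q : Type*} [TopologicalSpace Q] [ChartedSpace H Q] [IsManifold I ∞ Q] [T2Space Q]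
  {F : Type*} [NormedAddCommGroup F] [NormedSpace ℝ F] [FiniteDimensional ℝ F]
  {V : Q → Type*} [TopologicalSpace (TotalSpace F V)]
  [∀ q, AddCommGroup (V q)] [∀ q, Module ℝ (V q)] [∀ q, TopologicalSpace (V q)]
  [∀ q, IsTopologicalAddGroup (V q)] [∀ q, ContinuousSMul ℝ (V q)]
  [FiberBundle F V] [VectorBundle ℝ F V] [ContMDiffVectorBundle ∞ F V I]

variable {cov : (∀ q : Q, TangentSpace I q) → ∀ q : Q, TangentSpace I q →L[ℝ] TangentSpace I q}
  {nabla : CovariantDerivative I F V} {x : LPDual I F V}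

theorem isHorizontalSection_epsilon (h : ∃ s, IsHorizontalSection cov nabla x s) :
    IsHorizontalSection cov nabla x
      (Classical.epsilon fun s ↦ IsHorizontalSection cov nabla x s) :=
  Classical.epsilon_spec h

variable (cov nabla) in
/-- The partial derivatives `(∂f/∂p, ∂f/∂ν, ∂f/∂q)`. -/
def differential (f : LPDual I F V → ℝ) (x : LPDual I F V) :
    TangentSpace I x.proj × V x.proj × (TangentSpace I x.proj →L[ℝ] ℝ) :=
  (derivP f x, derivNu f x, derivQ cov nabla f x)

theorem IsAffine.exists_hasFiberDeriv {a : DualAlgebra I F V} (ha : IsAffine a)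
    (x : LPDual I F V) : ∃ ξ v, HasFiberDeriv a x ξ v := by
  obtain ⟨f, rfl⟩ | ⟨X, w, rfl⟩ := ha
  exacts [⟨_, _, hasFiberDeriv_pullback f⟩, ⟨_, _, hasFiberDeriv_linear X w⟩]

theorem exists_hasFiberDeriv (f : DualAlgebra I F V) (x : LPDual I F V) :
    ∃ ξ v, HasFiberDeriv f x ξ v := by
  obtain ⟨ι, _, u, hu, W, hW, h⟩ := exists_affine_coordinates (I := I) (F := F) (V := V) x.proj
  obtain ⟨G, hG, hf⟩ := h f
  choose ξ v h using fun i ↦ (hu i).exists_hasFiberDeriv x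
  classical
  exact ⟨_, _, HasFiberDeriv.comp_pi h ((hG.differentiable (by simp)).differentiableAt.hasFDerivAt)
    fun y hy ↦ hf y (hy ▸ mem_of_mem_nhds hW)⟩

/-- All smooth functions are differentiable along the fibres, as they are smooth functions of
affine ones there; so `derivP` and `derivNu` are not junk values. -/
theorem hasFiberDeriv (f : DualAlgebra I F V) (x : LPDual I F V) :
    HasFiberDeriv f x (derivP f x) (derivNu f x) := by
  obtain ⟨ξ, v, h⟩ := exists_hasFiberDeriv f x
  rwa [h.derivP_eq, h.derivNu_eq]

/-- The chain rule for functions which are smooth functions of others near the fibre of `x`. -/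
theorem differential_eq_sum (hs : ∃ s, IsHorizontalSection cov nabla x s) {ι : Type*} [Fintype ι]
    [DecidableEq ι] (u : ι → DualAlgebra I F V) {G : (ι → ℝ) → ℝ} {G' : (ι → ℝ) →L[ℝ] ℝ}
    (hG : HasFDerivAt G G' fun i ↦ u i x) {f : LPDual I F V → ℝ}
    (hf : ∀ᶠ q in 𝓝 x.proj, ∀ t, f ⟨q, t⟩ = G fun i ↦ u i ⟨q, t⟩) :
    differential cov nabla f x = ∑ i, G' (Pi.single i 1) • differential cov nabla (u i) x := by
  have h1 := HasFiberDeriv.comp_pi (f := f) (fun i ↦ hasFiberDeriv (u i) x) hG (by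
    rintro ⟨q, t⟩ rfl
    exact hf.self_of_nhds t)
  refine Prod.ext ?_ (Prod.ext ?_ ?_)
  · simp only [Prod.fst_sum]
    exact h1.derivP_eq
  · simp only [Prod.snd_sum, Prod.fst_sum]
    exact h1.derivNu_eq
  · simp only [Prod.snd_sum]
    set s := Classical.epsilon fun s ↦ IsHorizontalSection cov nabla x s with hs_def
    have hs := isHorizontalSection_epsilon hs
    rw [← hs_def] at hs
    have hσ (i) : MDifferentiableAt I 𝓘(ℝ) (fun q ↦ u i ⟨q, s q⟩) x.proj :=
      ((u i).contMDiff.mdifferentiable (by simp)).mdifferentiableAt.comp x.proj hs.differentiable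
    have hpi : HasMFDerivAt I 𝓘(ℝ, ι → ℝ) (fun q i ↦ u i ⟨q, s q⟩) x.proj
        (ContinuousLinearMap.pi fun i ↦ mvfderiv I (fun q ↦ u i ⟨q, s q⟩) x.proj) :=
      ⟨continuousAt_pi.2 fun i ↦ (hσ i).continuousAt,
        hasFDerivWithinAt_pi.2 fun i ↦ (hσ i).hasMFDerivAt.2⟩
    have h0 : (fun i ↦ u i x) = fun i ↦ u i ⟨x.proj, s x.proj⟩ := by rw [hs.through]
    rw [h0] at hG
    have hf' : (fun q ↦ f ⟨q, s q⟩) =ᶠ[𝓝 x.proj] fun q ↦ G fun i ↦ u i ⟨q, s q⟩ :=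
      hf.mono fun q hq ↦ hq _
    refine hf'.mvfderiv_eq.trans ((hG.hasMFDerivAt.comp x.proj hpi).mfderiv.trans ?_)
    ext X
    have h2 (y : ι → ℝ) : G' y = ∑ i, G' (Pi.single i 1) • y i := by
      conv_lhs => rw [pi_eq_sum_univ' y]
      simp only [map_sum, map_smul, smul_eq_mul, mul_comm]
    refine (h2 _).trans ?_
    exact (_root_.sum_apply _ (fun i ↦ G' (Pi.single i 1) •
      mvfderiv I (fun q ↦ u i ⟨q, s q⟩) x.proj) X).symm

end Differential

/-! ### The bracket of affine functions -/

section Affine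

variable {E : Type*} [NormedAddCommGroup E] [NormedSpace ℝ E] [FiniteDimensional ℝ E]
  {H : Type*} [TopologicalSpace H] {I : ModelWithCorners ℝ E H} [I.Boundaryless]
  {Q : Type*} [TopologicalSpace Q] [ChartedSpace H Q] [IsManifold I ∞ Q] [T2Space Q]
  {F : Type*} [NormedAddCommGroup F] [NormedSpace ℝ F] [FiniteDimensional ℝ F]
  {V : Q → Type*} [TopologicalSpace (TotalSpace F V)]
  [∀ q, AddCommGroup (V q)] [∀ q, Module ℝ (V q)] [∀ q, TopologicalSpace (V q)]
  [∀ q, IsTopologicalAddGroup (V q)] [∀ q, ContinuousSMul ℝ (V q)]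
  [FiberBundle F V] [VectorBundle ℝ F V] [ContMDiffVectorBundle ∞ F V I]

/-- The derivative `X[f]` of a smooth function along a smooth vector field. -/
def lieDerivative (X : Cₛ^∞⟮I; E, (TangentSpace I : Q → Type _)⟯) (f : C^∞⟮I, Q; 𝓘(ℝ), ℝ⟯) :
    C^∞⟮I, Q; 𝓘(ℝ), ℝ⟯ :=
  ⟨fun q ↦ mvfderiv I f q (X q),
    (contMDiff_snd_tangentBundle_modelSpace (n := ∞) ℝ 𝓘(ℝ)).comp
      ((f.contMDiff.contMDiff_tangentMap (m := ∞) (by simp)).comp X.contMDiff)⟩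

/-- The first component of the bracket of two smooth sections of `TQ ⊕ V`. -/
def bracketFst (X₁ X₂ : Cₛ^∞⟮I; E, (TangentSpace I : Q → Type _)⟯) :
    Cₛ^∞⟮I; E, (TangentSpace I : Q → Type _)⟯ :=
  ⟨VectorField.mlieBracket I X₁ X₂,
    haveI : IsManifold I (minSmoothness ℝ 2) Q := by
      rw [minSmoothness_of_isRCLikeNormedField]
      infer_instance
    haveI : IsManifold I (∞ + 1) Q := inferInstanceAs (IsManifold I ∞ Q)
    ContDiff.mlieBracket_vectorField (m := ⊤) (n := ⊤) X₁.contMDiff X₂.contMDiff (by simp)⟩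

theorem contMDiff_nabla (nabla : CovariantDerivative I F V)
    (h : CovariantDerivative.ContMDiffCovariantDerivative nabla ∞)
    (X : Cₛ^∞⟮I; E, (TangentSpace I : Q → Type _)⟯) (w : Cₛ^∞⟮I; F, V⟯) :
    ContMDiff I (I.prod 𝓘(ℝ, F)) ∞ fun q ↦ TotalSpace.mk' F q (nabla w q (X q)) := by
  have h1 := h.contMDiff.contMDiff (σ := w) (w.contMDiff.contMDiffOn.of_le (by simp))
  exact (contMDiffOn_univ.1 h1).clm_bundle_apply X.contMDiff

theorem contMDiff_bracketSnd (S : PreLPBundle I F V)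
    (X₁ X₂ : Cₛ^∞⟮I; E, (TangentSpace I : Q → Type _)⟯) (w₁ w₂ : Cₛ^∞⟮I; F, V⟯) :
    ContMDiff I (I.prod 𝓘(ℝ, F)) ∞
      fun q ↦ TotalSpace.mk' F q ((S.bracket (⇑X₁, ⇑w₁) (⇑X₂, ⇑w₂)).2 q) :=
  (((contMDiff_nabla S.nabla S.nabla_smooth X₁ w₂).sub_section
    (contMDiff_nabla S.nabla S.nabla_smooth X₂ w₁)).sub_section
    ((S.form_smooth.clm_bundle_apply X₁.contMDiff).clm_bundle_apply X₂.contMDiff)).add_section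
    ((S.lie_smooth.clm_bundle_apply w₁.contMDiff).clm_bundle_apply w₂.contMDiff)

/-- The second component of the bracket of two smooth sections of `TQ ⊕ V`. -/
def PreLPBundle.bracketSnd (S : PreLPBundle I F V)
    (X₁ X₂ : Cₛ^∞⟮I; E, (TangentSpace I : Q → Type _)⟯) (w₁ w₂ : Cₛ^∞⟮I; F, V⟯) :
    Cₛ^∞⟮I; F, V⟯ :=
  ⟨(S.bracket (⇑X₁, ⇑w₁) (⇑X₂, ⇑w₂)).2, contMDiff_bracketSnd S X₁ X₂ w₁ w₂⟩

/-- `[X₁, X₂]` acts on functions as the commutator of `X₁` and `X₂`. -/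
theorem lieDerivative_bracketFst (X₁ X₂ : Cₛ^∞⟮I; E, (TangentSpace I : Q → Type _)⟯)
    (f : C^∞⟮I, Q; 𝓘(ℝ), ℝ⟯) : lieDerivative (bracketFst X₁ X₂) f
      = lieDerivative X₁ (lieDerivative X₂ f) - lieDerivative X₂ (lieDerivative X₁ f) := by
  ext q
  exact mvfderiv_mlieBracket f.contMDiff.contMDiffAt (X₁.contMDiff.mdifferentiable (by simp) q)
    (X₂.contMDiff.mdifferentiable (by simp) q)

theorem pullback_sub (f g : C^∞⟮I, Q; 𝓘(ℝ), ℝ⟯) :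
    pullback F V (f - g) = pullback F V f - pullback F V g := rfl

namespace PreLPBundle.IsAffineBracket

variable {S : PreLPBundle I F V}
  {B B' : DualAlgebra I F V →ₗ[ℝ] DualAlgebra I F V →ₗ[ℝ] DualAlgebra I F V}

theorem pullback_linear_eq (h : S.IsAffineBracket B) (f : C^∞⟮I, Q; 𝓘(ℝ), ℝ⟯)
    (X : Cₛ^∞⟮I; E, (TangentSpace I : Q → Type _)⟯) (w : Cₛ^∞⟮I; F, V⟯) :
    B (pullback F V f) (linear X w) = pullback F V (lieDerivative X f) := by
  ext x
  exact h.pullback_linear f X w x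

theorem linear_linear_eq (h : S.IsAffineBracket B)
    (X₁ X₂ : Cₛ^∞⟮I; E, (TangentSpace I : Q → Type _)⟯) (w₁ w₂ : Cₛ^∞⟮I; F, V⟯) :
    B (linear X₁ w₁) (linear X₂ w₂)
      = -linear (bracketFst X₁ X₂) (S.bracketSnd X₁ X₂ w₁ w₂) := by
  ext x
  exact h.linear_linear X₁ X₂ w₁ w₂ x

theorem eq_of_isAffine (h : S.IsAffineBracket B) (h' : S.IsAffineBracket B') (halt : ∀ a, B a a = 0)
    (halt' : ∀ a, B' a a = 0) {a b : DualAlgebra I F V} (ha : IsAffine a) (hb : IsAffine b) :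
    B a b = B' a b := by
  obtain ⟨f, rfl⟩ | ⟨X, w, rfl⟩ := ha <;> obtain ⟨f', rfl⟩ | ⟨X', w', rfl⟩ := hb
  · rw [h.pullback_pullback, h'.pullback_pullback]
  · rw [h.pullback_linear_eq, h'.pullback_linear_eq]
  · rw [← LinearMap.IsAlt.neg (B := B) halt, ← LinearMap.IsAlt.neg (B := B') halt',
      h.pullback_linear_eq, h'.pullback_linear_eq]
  · rw [h.linear_linear_eq, h'.linear_linear_eq]

end PreLPBundle.IsAffineBracket

/-- On affine functions the Jacobi identity is the one of `TQ ⊕ V` if all three are linear, the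
identity `[X₁, X₂][f] = X₁[X₂[f]] - X₂[X₁[f]]` if two of them are, and trivial otherwise. -/
theorem LPBundle.jacobi_of_isAffine (S : LPBundle I F V)
    {B : DualAlgebra I F V →ₗ[ℝ] DualAlgebra I F V →ₗ[ℝ] DualAlgebra I F V}
    (h : S.IsAffineBracket B) (halt : ∀ a, B a a = 0) {a b c : DualAlgebra I F V}
    (ha : IsAffine a) (hb : IsAffine b) (hc : IsAffine c) :
    B a (B b c) + B b (B c a) + B c (B a b) = 0 := by
  have hs (X w f) : B (linear X w) (pullback F V f) = -pullback F V (lieDerivative X f) := by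
    rw [← LinearMap.IsAlt.neg (B := B) halt, h.pullback_linear_eq]
  have h1 (f f' X w) : B (pullback F V f) (B (pullback F V f') (linear X w))
      + B (pullback F V f') (B (linear X w) (pullback F V f))
      + B (linear X w) (B (pullback F V f) (pullback F V f')) = 0 := by
    rw [h.pullback_linear_eq, hs, map_neg, h.pullback_pullback, h.pullback_pullback,
      h.pullback_pullback, map_zero, neg_zero, add_zero, add_zero]
  have h2 (f X w X' w') : B (pullback F V f) (B (linear X w) (linear X' w'))
      + B (linear X w) (B (linear X' w') (pullback F V f))
      + B (linear X' w') (B (pullback F V f) (linear X w)) = 0 := by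
    rw [h.linear_linear_eq, h.pullback_linear_eq, hs, map_neg, map_neg, hs, hs,
      h.pullback_linear_eq, lieDerivative_bracketFst, pullback_sub]
    abel
  have h3 (X w X' w' X'' w'') : B (linear X w) (B (linear X' w') (linear X'' w''))
      + B (linear X' w') (B (linear X'' w'') (linear X w))
      + B (linear X'' w'') (B (linear X w) (linear X' w')) = 0 := by
    simp only [h.linear_linear_eq, map_neg, neg_neg]
    ext x
    have hadd (a b : (∀ q : Q, TangentSpace I q) × (∀ q, V q)) :
        linearFun (a + b) x = linearFun a x + linearFun b x := by
      simp only [linearFun, Prod.fst_add, Prod.snd_add, Pi.add_apply, map_add]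
      ring
    refine (((hadd _ _).trans (congrArg (· + _) (hadd _ _))).symm.trans
      (congrArg (fun a ↦ linearFun a x) (S.jacobi X X' X'' w w' w''))).trans ?_
    simp [linearFun]
  have hcyc (a b c) : B a (B b c) + B b (B c a) + B c (B a b)
      = B b (B c a) + B c (B a b) + B a (B b c) := by abel
  obtain ⟨f, rfl⟩ | ⟨X, w, rfl⟩ := ha <;> obtain ⟨f', rfl⟩ | ⟨X', w', rfl⟩ := hb <;>
    obtain ⟨f'', rfl⟩ | ⟨X'', w'', rfl⟩ := hc
  · simp only [h.pullback_pullback, map_zero, add_zero]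
  · exact h1 _ _ _ _
  · rw [hcyc, hcyc]
    exact h1 _ _ _ _
  · exact h2 _ _ _ _ _
  · rw [hcyc]
    exact h1 _ _ _ _
  · rw [hcyc]
    exact h2 _ _ _ _ _
  · rw [hcyc, hcyc]
    exact h2 _ _ _ _ _
  · exact h3 _ _ _ _ _ _

end Affine

/-! ### The explicit bracket -/

section Explicit

variable {E : Type*} [NormedAddCommGroup E] [NormedSpace ℝ E] [FiniteDimensional ℝ E]
  {H : Type*} [TopologicalSpace H] {I : ModelWithCorners ℝ E H} [I.Boundaryless]
  {Q : Type*} [TopologicalSpace Q] [ChartedSpace H Q] [IsManifold I ∞ Q] [T2Space Q]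
  {F : Type*} [NormedAddCommGroup F] [NormedSpace ℝ F] [FiniteDimensional ℝ F]
  {V : Q → Type*} [TopologicalSpace (TotalSpace F V)]
  [∀ q, AddCommGroup (V q)] [∀ q, Module ℝ (V q)] [∀ q, TopologicalSpace (V q)]
  [∀ q, IsTopologicalAddGroup (V q)] [∀ q, ContinuousSMul ℝ (V q)]
  [FiberBundle F V] [VectorBundle ℝ F V] [ContMDiffVectorBundle ∞ F V I]

theorem PreLPBundle.lie_skew (S : PreLPBundle I F V) (q : Q) (v w : V q) :
    S.lie q v w = -S.lie q w v := by
  have h := S.lie_self q (v + w)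
  simp only [map_add, add_apply, S.lie_self, zero_add, add_zero] at h
  exact eq_neg_of_add_eq_zero_right h

/-- The explicit bracket as a bilinear form in the partial derivatives of the two functions. -/
def PreLPBundle.poissonForm (S : PreLPBundle I F V) (x : LPDual I F V) :
    (TangentSpace I x.proj × V x.proj × (TangentSpace I x.proj →L[ℝ] ℝ)) →ₗ[ℝ]
      (TangentSpace I x.proj × V x.proj × (TangentSpace I x.proj →L[ℝ] ℝ)) →ₗ[ℝ] ℝ :=
  LinearMap.mk₂ ℝ (fun a b ↦ a.2.2 b.1 - b.2.2 a.1 + x.2.2 (S.form x.proj a.1 b.1)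
      + x.2.2 (S.lie x.proj b.2.1 a.2.1))
    (fun a a' b ↦ by simp; ring) (fun r a b ↦ by simp; ring)
    (fun a b b' ↦ by simp; ring) (fun r a b ↦ by simp; ring)

theorem PreLPBundle.poissonForm_self (S : PreLPBundle I F V) (x : LPDual I F V)
    (a : TangentSpace I x.proj × V x.proj × (TangentSpace I x.proj →L[ℝ] ℝ)) :
    S.poissonForm x a a = 0 := by
  simp [PreLPBundle.poissonForm, S.form_self, S.lie_self]

variable {cov : (∀ q : Q, TangentSpace I q) → ∀ q : Q, TangentSpace I q →L[ℝ] TangentSpace I q}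
  {nabla : CovariantDerivative I F V} {x : LPDual I F V}

theorem explicitBracket_eq_poissonForm (S : PreLPBundle I F V) (f g : LPDual I F V → ℝ) :
    S.explicitBracket cov f g x
      = S.poissonForm x (differential cov S.nabla f x) (differential cov S.nabla g x) := rfl

theorem derivQ_pullback (f : C^∞⟮I, Q; 𝓘(ℝ), ℝ⟯) :
    derivQ cov nabla (pullback F V f) x = mvfderiv I f x.proj := rfl

theorem derivQ_linear (hs : ∃ s, IsHorizontalSection cov nabla x s)
    (X : Cₛ^∞⟮I; E, (TangentSpace I : Q → Type _)⟯) (w : Cₛ^∞⟮I; F, V⟯)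
    (Y : TangentSpace I x.proj) :
    derivQ cov nabla (linear X w) x Y = x.2.1 (cov X x.proj Y) + x.2.2 (nabla w x.proj Y) := by
  rw [derivQ]
  set s := Classical.epsilon fun s ↦ IsHorizontalSection cov nabla x s with hs_def
  have hs := isHorizontalSection_epsilon hs
  rw [← hs_def] at hs
  have hd (X : Cₛ^∞⟮I; E, (TangentSpace I : Q → Type _)⟯) (w : Cₛ^∞⟮I; F, V⟯) :
      MDifferentiableAt I 𝓘(ℝ) (fun q ↦ linear X w ⟨q, s q⟩) x.proj :=
    ((linear X w).contMDiff.mdifferentiable (by simp)).mdifferentiableAt.comp x.proj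
      hs.differentiable
  have h1 : (fun q ↦ linear X (0 : Cₛ^∞⟮I; F, V⟯) ⟨q, s q⟩) = fun q ↦ ((s q).1 (X q) : ℝ) := by
    ext q
    change (s q).1 (X q) + (s q).2 0 = _
    rw [map_zero, add_zero]
  have h2 : (fun q ↦ linear 0 w ⟨q, s q⟩) = fun q ↦ ((s q).2 (w q) : ℝ) := by
    ext q
    change (s q).1 0 + (s q).2 (w q) = _
    rw [map_zero, zero_add]
  have h3 : (fun q ↦ linear X w ⟨q, s q⟩)
      = (fun q ↦ ((s q).1 (X q) : ℝ)) + fun q ↦ ((s q).2 (w q) : ℝ) := rfl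
  rw [h3, mvfderiv_add (h1 ▸ hd X 0) (h2 ▸ hd 0 w)]
  exact congrArg₂ (· + ·) (hs.parallel_fst X (X.contMDiff.mdifferentiable (by simp) _) Y)
    (hs.parallel_snd w (w.contMDiff.mdifferentiable (by simp) _) Y)

theorem derivP_pullback (f : C^∞⟮I, Q; 𝓘(ℝ), ℝ⟯) : derivP (pullback F V f) x = 0 :=
  (hasFiberDeriv_pullback f).derivP_eq

theorem derivNu_pullback (f : C^∞⟮I, Q; 𝓘(ℝ), ℝ⟯) : derivNu (pullback F V f) x = 0 :=
  (hasFiberDeriv_pullback f).derivNu_eq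

theorem derivP_linear (X : Cₛ^∞⟮I; E, (TangentSpace I : Q → Type _)⟯) (w : Cₛ^∞⟮I; F, V⟯) :
    derivP (linear X w) x = X x.proj := (hasFiberDeriv_linear X w).derivP_eq

theorem derivNu_linear (X : Cₛ^∞⟮I; E, (TangentSpace I : Q → Type _)⟯) (w : Cₛ^∞⟮I; F, V⟯) :
    derivNu (linear X w) x = w x.proj := (hasFiberDeriv_linear X w).derivNu_eq

theorem explicitBracket_swap (S : PreLPBundle I F V) (f g : LPDual I F V → ℝ) :
    S.explicitBracket cov f g x = -S.explicitBracket cov g f x := by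
  rw [explicitBracket_eq_poissonForm, explicitBracket_eq_poissonForm]
  exact (LinearMap.IsAlt.neg (B := S.poissonForm x) (S.poissonForm_self x) _ _).symm

theorem explicitBracket_pullback_pullback (S : PreLPBundle I F V) (f g : C^∞⟮I, Q; 𝓘(ℝ), ℝ⟯) :
    S.explicitBracket cov (pullback F V f) (pullback F V g) x = 0 := by
  simp [PreLPBundle.explicitBracket, derivP_pullback, derivNu_pullback]

theorem explicitBracket_pullback_linear (S : PreLPBundle I F V) (f : C^∞⟮I, Q; 𝓘(ℝ), ℝ⟯)
    (X : Cₛ^∞⟮I; E, (TangentSpace I : Q → Type _)⟯) (w : Cₛ^∞⟮I; F, V⟯) :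
    S.explicitBracket cov (pullback F V f) (linear X w) x = mvfderiv I f x.proj (X x.proj) := by
  simp [PreLPBundle.explicitBracket, derivP_pullback, derivNu_pullback, derivP_linear,
    derivQ_pullback]

/-- The only value that depends on the connection, through its torsion alone. -/
theorem explicitBracket_linear_linear (S : PreLPBundle I F V)
    (hs : ∃ s, IsHorizontalSection cov S.nabla x s) {U : Set Q}
    (hcov : IsTorsionFreeConnectionOn cov U) (hx : x.proj ∈ U)
    (X₁ X₂ : Cₛ^∞⟮I; E, (TangentSpace I : Q → Type _)⟯) (w₁ w₂ : Cₛ^∞⟮I; F, V⟯) :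
    S.explicitBracket cov (linear X₁ w₁) (linear X₂ w₂) x
      = -linearFun (S.bracket (⇑X₁, ⇑w₁) (⇑X₂, ⇑w₂)) x := by
  have h := hcov.torsion_eq_zero x.proj hx X₁ X₂ (X₁.contMDiff.mdifferentiable (by simp) _)
    (X₂.contMDiff.mdifferentiable (by simp) _)
  simp only [PreLPBundle.explicitBracket, derivP_linear, derivNu_linear, derivQ_linear hs,
    linearFun, PreLPBundle.bracket, ← h, S.lie_skew _ (w₂ x.proj), map_sub, map_add, map_neg]
  ring

end Explicit

/-! ### The bracket on all smooth functions -/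

section Main

variable {E : Type*} [NormedAddCommGroup E] [NormedSpace ℝ E] [FiniteDimensional ℝ E]
  {H : Type*} [TopologicalSpace H] {I : ModelWithCorners ℝ E H} [I.Boundaryless]
  {Q : Type*} [TopologicalSpace Q] [ChartedSpace H Q] [IsManifold I ∞ Q] [T2Space Q]
  {F : Type*} [NormedAddCommGroup F] [NormedSpace ℝ F] [FiniteDimensional ℝ F]
  {V : Q → Type*} [TopologicalSpace (TotalSpace F V)]
  [∀ q, AddCommGroup (V q)] [∀ q, Module ℝ (V q)] [∀ q, TopologicalSpace (V q)]
  [∀ q, IsTopologicalAddGroup (V q)] [∀ q, ContinuousSMul ℝ (V q)]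
  [FiberBundle F V] [VectorBundle ℝ F V] [ContMDiffVectorBundle ∞ F V I]

section Differential

variable {cov : (∀ q : Q, TangentSpace I q) → ∀ q : Q, TangentSpace I q →L[ℝ] TangentSpace I q}
  {nabla : CovariantDerivative I F V} {x : LPDual I F V}

theorem differential_add (hs : ∃ s, IsHorizontalSection cov nabla x s) (f g : DualAlgebra I F V) :
    differential cov nabla (f + g : DualAlgebra I F V) x
      = differential cov nabla f x + differential cov nabla g x := by
  have hG : HasFDerivAt (fun y : Fin 2 → ℝ ↦ y 0 + y 1)
      (ContinuousLinearMap.proj (R := ℝ) (φ := fun _ : Fin 2 ↦ ℝ) 0 + ContinuousLinearMap.proj 1)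
      fun i ↦ ![f, g] i x := (hasFDerivAt_apply 0 _).add (hasFDerivAt_apply 1 _)
  rw [differential_eq_sum hs ![f, g] hG (.of_forall fun q t ↦ rfl)]
  simp

theorem differential_smul (hs : ∃ s, IsHorizontalSection cov nabla x s) (r : ℝ)
    (f : DualAlgebra I F V) :
    differential cov nabla (r • f : DualAlgebra I F V) x = r • differential cov nabla f x := by
  have hG : HasFDerivAt (fun y : Fin 1 → ℝ ↦ r * y 0)
      (r • ContinuousLinearMap.proj (R := ℝ) (φ := fun _ : Fin 1 ↦ ℝ) 0)
      fun i ↦ ![f] i x := (hasFDerivAt_apply 0 _).const_mul r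
  rw [differential_eq_sum hs ![f] hG (.of_forall fun q t ↦ rfl)]
  simp

theorem differential_mul (hs : ∃ s, IsHorizontalSection cov nabla x s) (f g : DualAlgebra I F V) :
    differential cov nabla (f * g : DualAlgebra I F V) x
      = f x • differential cov nabla g x + g x • differential cov nabla f x := by
  have hG : HasFDerivAt (fun y : Fin 2 → ℝ ↦ y 0 * y 1)
      (f x • ContinuousLinearMap.proj (R := ℝ) (φ := fun _ : Fin 2 ↦ ℝ) 1
        + g x • ContinuousLinearMap.proj 0)
      fun i ↦ ![f, g] i x :=
    (hasFDerivAt_apply (𝕜 := ℝ) (0 : Fin 2) fun i ↦ ![f, g] i x).fun_mul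
      (hasFDerivAt_apply (𝕜 := ℝ) (1 : Fin 2) _)
  rw [differential_eq_sum hs ![f, g] hG (.of_forall fun q t ↦ rfl)]
  simp [add_comm]

/-- The chain rule for the explicit bracket. -/
theorem explicitBracket_eq_sum (S : PreLPBundle I F V)
    (hs : ∃ s, IsHorizontalSection cov S.nabla x s) {ι : Type*} [Fintype ι] [DecidableEq ι]
    (u : ι → DualAlgebra I F V) {G K : (ι → ℝ) → ℝ} {G' K' : (ι → ℝ) →L[ℝ] ℝ}
    (hG : HasFDerivAt G G' fun i ↦ u i x) (hK : HasFDerivAt K K' fun i ↦ u i x)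
    {f g : LPDual I F V → ℝ} {W : Set Q} (hW : W ∈ 𝓝 x.proj)
    (hf : ∀ y : LPDual I F V, y.proj ∈ W → f y = G fun i ↦ u i y)
    (hg : ∀ y : LPDual I F V, y.proj ∈ W → g y = K fun i ↦ u i y) :
    S.explicitBracket cov f g x = ∑ i, ∑ j, G' (Pi.single i 1) * K' (Pi.single j 1) *
      S.explicitBracket cov (u i) (u j) x := by
  simp only [explicitBracket_eq_poissonForm]
  rw [differential_eq_sum hs u hG (Filter.mem_of_superset hW fun q hq t ↦ hf _ hq),
    differential_eq_sum hs u hK (Filter.mem_of_superset hW fun q hq t ↦ hg _ hq)]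
  simp only [map_sum, map_smul, LinearMap.sum_apply, LinearMap.smul_apply, smul_eq_mul,
    Finset.mul_sum]
  rw [Finset.sum_comm]
  exact Finset.sum_congr rfl fun i _ ↦ Finset.sum_congr rfl fun j _ ↦ by ring

end Differential

variable (S : PreLPBundle I F V)

theorem IsTorsionFreeConnectionOn.exists_isHorizontalSection
    {cov : (∀ q : Q, TangentSpace I q) → ∀ q : Q, TangentSpace I q →L[ℝ] TangentSpace I q}
    {U : Set Q} (hcov : IsTorsionFreeConnectionOn cov U) (nabla : CovariantDerivative I F V)
    {x : LPDual I F V} (hx : x.proj ∈ U) : ∃ s, IsHorizontalSection cov nabla x s :=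
  LagrangePoincare.exists_isHorizontalSection hcov.isCovariantDerivativeOn nabla x hx

/-- `c` is the bracket `{f, g}` given by the explicit formula, whichever torsion-free connection is
used in it. -/
def PreLPBundle.IsExplicitBracket (f g c : DualAlgebra I F V) : Prop :=
  ∀ cov U, IsTorsionFreeConnectionOn cov U → ∀ x : LPDual I F V, x.proj ∈ U →
    S.explicitBracket cov f g x = c x

theorem isTorsionFreeConnectionOn_chartAt (q : Q) :
    IsTorsionFreeConnectionOn (chartConnection (I := I) (chartAt H q)) (chartAt H q).source :=
  isTorsionFreeConnectionOn_chartConnection (IsManifold.chart_mem_maximalAtlas q)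

theorem PreLPBundle.IsExplicitBracket.apply_eq {f g c : DualAlgebra I F V}
    (h : S.IsExplicitBracket f g c) (x : LPDual I F V) :
    S.explicitBracket (chartConnection (chartAt H x.proj)) f g x = c x :=
  h _ _ (isTorsionFreeConnectionOn_chartAt x.proj) x (mem_chart_source H x.proj)

theorem exists_isExplicitBracket_of_isAffine {a b : DualAlgebra I F V} (ha : IsAffine a)
    (hb : IsAffine b) : ∃ c, S.IsExplicitBracket a b c := by
  obtain ⟨f, rfl⟩ | ⟨X, w, rfl⟩ := ha <;> obtain ⟨f', rfl⟩ | ⟨X', w', rfl⟩ := hb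
  · exact ⟨0, fun cov U hcov x hx ↦ explicitBracket_pullback_pullback S f f'⟩
  · exact ⟨pullback F V (lieDerivative X' f), fun cov U hcov x hx ↦
      explicitBracket_pullback_linear S f X' w'⟩
  · refine ⟨-pullback F V (lieDerivative X f'), fun cov U hcov x hx ↦ ?_⟩
    rw [explicitBracket_swap, explicitBracket_pullback_linear]
    rfl
  · exact ⟨-linear (bracketFst X X') (S.bracketSnd X X' w w'), fun cov U hcov x hx ↦
      explicitBracket_linear_linear S (hcov.exists_isHorizontalSection S.nabla hx) hcov hx
        X X' w w'⟩

/-- For any two smooth functions the explicit bracket is smooth and independent of the connection: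
near a fibre it is a combination of brackets of affine functions with smooth coefficients that do
not involve the connection. -/
theorem exists_isExplicitBracket (f g : DualAlgebra I F V) : ∃ c, S.IsExplicitBracket f g c := by
  classical
  have key (q₀ : Q) : ∃ c : DualAlgebra I F V, ∃ W ∈ 𝓝 q₀, ∀ cov U,
      IsTorsionFreeConnectionOn cov U → ∀ x : LPDual I F V, x.proj ∈ W → x.proj ∈ U →
        S.explicitBracket cov f g x = c x := by
    obtain ⟨ι, _, u, hu, W, hW, h⟩ := exists_affine_coordinates (I := I) (F := F) (V := V) q₀
    obtain ⟨G, hG, hf⟩ := h f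
    obtain ⟨K, hK, hg⟩ := h g
    choose c hc using fun i j ↦ exists_isExplicitBracket_of_isAffine S (hu i) (hu j)
    have hd {G : (ι → ℝ) → ℝ} (hG : ContDiff ℝ ∞ G) (i : ι) :
        ContDiff ℝ ∞ fun y ↦ fderiv ℝ G y (Pi.single i 1) :=
      (hG.fderiv_right (m := ∞) (by simp)).clm_apply contDiff_const
    refine ⟨∑ i, ∑ j, compSmooth (hd hG i) u * compSmooth (hd hK j) u * c i j,
      {q | W ∈ 𝓝 q}, eventually_mem_nhds_iff.2 hW, fun cov U hcov x hxW hx ↦ ?_⟩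
    rw [explicitBracket_eq_sum S (hcov.exists_isHorizontalSection S.nabla hx) u
      (hG.differentiable (by simp)).differentiableAt.hasFDerivAt
      (hK.differentiable (by simp)).differentiableAt.hasFDerivAt hxW hf hg]
    refine .trans ?_ (map_sum (evalAt x) _ _).symm
    refine Finset.sum_congr rfl fun i _ ↦ .trans ?_ (map_sum (evalAt x) _ _).symm
    refine Finset.sum_congr rfl fun j _ ↦ ?_
    rw [hc i j cov U hcov x hx]
    rfl
  refine ⟨⟨fun x ↦ S.explicitBracket (chartConnection (chartAt H x.proj)) f g x, fun x₀ ↦ ?_⟩,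
    fun cov U hcov x hx ↦ ?_⟩
  · obtain ⟨c, W, hW, h⟩ := key x₀.proj
    refine c.contMDiff.contMDiffAt.congr_of_eventuallyEq ?_
    have hproj : Continuous fun x : LPDual I F V ↦ x.proj := FiberBundle.continuous_proj _ _
    filter_upwards [hproj.continuousAt.preimage_mem_nhds hW] with x hx
    exact h _ _ (isTorsionFreeConnectionOn_chartAt x.proj) x hx (mem_chart_source H x.proj)
  · obtain ⟨c, W, hW, h⟩ := key x.proj
    exact (h cov U hcov x (mem_of_mem_nhds hW) hx).trans (h _ _
      (isTorsionFreeConnectionOn_chartAt x.proj) x (mem_of_mem_nhds hW)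
      (mem_chart_source H x.proj)).symm

theorem exists_bilinear_isExplicitBracket :
    ∃ B : DualAlgebra I F V →ₗ[ℝ] DualAlgebra I F V →ₗ[ℝ] DualAlgebra I F V,
      (∀ f g, S.IsExplicitBracket f g (B f g)) ∧ (∀ f, B f f = 0) ∧
      ∀ f g h, B f (g * h) = B f g * h + g * B f h := by
  choose B hB using exists_isExplicitBracket S
  have happly (f g) (x : LPDual I F V) : B f g x = S.poissonForm x
      (differential (chartConnection (chartAt H x.proj)) S.nabla f x)
      (differential (chartConnection (chartAt H x.proj)) S.nabla g x) :=
    ((hB f g).apply_eq S x).symm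
  have hs (x : LPDual I F V) :
      ∃ s, IsHorizontalSection (chartConnection (chartAt H x.proj)) S.nabla x s :=
    (isTorsionFreeConnectionOn_chartAt x.proj).exists_isHorizontalSection S.nabla
      (mem_chart_source H x.proj)
  refine ⟨LinearMap.mk₂ ℝ B (fun f f' g ↦ ?_) (fun r f g ↦ ?_) (fun f g g' ↦ ?_)
    fun r f g ↦ ?_, hB, fun f ↦ ?_, fun f g h ↦ ?_⟩
  · ext x
    change B _ _ x = B _ _ x + B _ _ x
    simp only [happly, differential_add (hs x), map_add, LinearMap.add_apply]
  · ext x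
    change B _ _ x = r • B _ _ x
    simp only [happly, differential_smul (hs x), map_smul, LinearMap.smul_apply]
  · ext x
    change B _ _ x = B _ _ x + B _ _ x
    simp only [happly, differential_add (hs x), map_add]
  · ext x
    change B _ _ x = r • B _ _ x
    simp only [happly, differential_smul (hs x), map_smul]
  · ext x
    exact (happly f f x).trans (S.poissonForm_self x _)
  · ext x
    change B _ _ x = B _ _ x * h x + g x * B _ _ x
    simp only [happly, differential_mul (hs x), map_add, map_smul, smul_eq_mul]
    ring

theorem isAffineBracket_of_isExplicitBracket
    {B : DualAlgebra I F V →ₗ[ℝ] DualAlgebra I F V →ₗ[ℝ] DualAlgebra I F V}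
    (hB : ∀ f g, S.IsExplicitBracket f g (B f g)) : S.IsAffineBracket B where
  pullback_pullback f g := by
    ext x
    rw [← (hB _ _).apply_eq S x, explicitBracket_pullback_pullback]
    rfl
  pullback_linear f X w x := by
    rw [← (hB _ _).apply_eq S x, explicitBracket_pullback_linear]
  linear_linear X₁ X₂ w₁ w₂ x := by
    have h := isTorsionFreeConnectionOn_chartAt (I := I) x.proj
    have hx := mem_chart_source H x.proj
    rw [← (hB _ _).apply_eq S x, explicitBracket_linear_linear S
      (h.exists_isHorizontalSection S.nabla hx) h hx]

end Main

end LagrangePoincare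

end

open LagrangePoincare
theorem mainTheorem9
    {E : Type*} [NormedAddCommGroup E] [NormedSpace ℝ E] [FiniteDimensional ℝ E]
    {H : Type*} [TopologicalSpace H] {I : ModelWithCorners ℝ E H} [I.Boundaryless]
    {Q : Type*} [TopologicalSpace Q] [ChartedSpace H Q] [IsManifold I ∞ Q] [T2Space Q]
    {F : Type*} [NormedAddCommGroup F] [NormedSpace ℝ F] [FiniteDimensional ℝ F]
    {V : Q → Type*} [TopologicalSpace (TotalSpace F V)]
    [∀ q, AddCommGroup (V q)] [∀ q, Module ℝ (V q)] [∀ q, TopologicalSpace (V q)]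
    [∀ q, IsTopologicalAddGroup (V q)] [∀ q, ContinuousSMul ℝ (V q)]
    [FiberBundle F V] [VectorBundle ℝ F V] [ContMDiffVectorBundle ∞ F V I]
    (S : LPBundle I F V) :
    ∃ B : DualAlgebra I F V →ₗ[ℝ] DualAlgebra I F V →ₗ[ℝ] DualAlgebra I F V,
      IsPoissonBracket B ∧ S.IsAffineBracket B ∧
      (∀ B', IsPoissonBracket B' → S.IsAffineBracket B' → B' = B) ∧
      (∀ φ ∈ IsManifold.maximalAtlas I ∞ Q, ∀ (f g : DualAlgebra I F V) (x : LPDual I F V),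
        x.proj ∈ φ.source → B f g x = S.explicitBracket (chartConnection φ) f g x) ∧
      (∀ cov U, IsTorsionFreeConnectionOn cov U →
        ∀ (f g : DualAlgebra I F V) (x : LPDual I F V),
          x.proj ∈ U → B f g x = S.explicitBracket cov f g x) := by
  obtain ⟨B, hB, halt, hleib⟩ := exists_bilinear_isExplicitBracket S.toPreLPBundle
  have haff := isAffineBracket_of_isExplicitBracket S.toPreLPBundle hB
  refine ⟨B, ⟨halt, ?_, hleib⟩, haff, fun B' hB' haff' ↦ ?_, fun φ hφ f g x hx ↦ ?_,
    fun cov U hcov f g x hx ↦ (hB f g cov U hcov x hx).symm⟩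
  · exact jacobi_of_forall_derivation derivation_eq_zero hleib halt
      fun a b c ha hb hc ↦ S.jacobi_of_isAffine haff halt ha hb hc
  · exact eq_of_forall_derivation derivation_eq_zero hB'.leibniz hB'.alternating hleib halt
      fun a b ha hb ↦ haff'.eq_of_isAffine haff hB'.alternating halt ha hb
  · exact (hB f g _ _ (isTorsionFreeConnectionOn_chartConnection hφ) x hx).symm
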